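/- All graphs are finite and simple. A \emph{proper interval graph} is a graph $G=(V,E)$ that has a proper interval representation: closed intervals $T_v=[L(v),R(v)]$, $v\in V$, on the real line, none properly containing another, such that distinct vertices $u,v$ are adjacent if and only if $T_u\cap T_v\neq\emptyset$. A \emph{proper interval order} of $G$ is a listing $v_0,v_1,\dots,v_{n-1}$ of all its vertices that is sorted by $L$, with ties broken by $R$, for some proper interval representation of $G$. An \emph{equitable tree-$k$-coloring} of $G$ is a map $c\colon V\to\{0,\dots,k-1\}$ such that every color class induces a forest and the sizes of any two color classes (empty classes included) differ by at most one. Consider the following algorithm. Given a proper interval graph $G$ on $n$ vertices and an integer $k>0$, sort the vertices into a proper interval order $v_0,\dots,v_{n-1}$; give $v_i$ the color $i \bmod k$, for $0\le i\le n-1$; output NO if some cycle of $G$ has all its vertices in one color class, and YES otherwise. \textbf{Theorem.} (i) For every proper interval graph $G$, every integer $k>0$ and every proper interval order of $G$ used in the sorting step, the algorithm outputs YES if and only if $G$ has an equitable tree-$k$-coloring; and if it outputs YES, then the coloring it has produced is an equitable tree-$k$-coloring of $G$. (ii) The algorithm runs in linear time: there is a single unit-cost random access machine program which, given $k>0$ and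 a proper interval graph $G=(V,E)$ on the vertices $0,\dots,n-1$ by adjacency lists (each in arbitrary order), carries out the algorithm, including the computation of a proper interval order, in at most $C\,(|V|+|E|+1)$ steps, where $C$ is an absolute constant, and outputs the order, the coloring and the answer YES or NO. In particular, whether a proper interval graph $G$ admits an equitable tree-$k$-coloring for a given integer $k>0$ can be decided in time $O(|V|+|E|)$, and such a coloring is produced if one exists. -/

import Mathlib

namespace EquitableTree

/-! ### Proper interval graphs and their orders -/

/-- `T v = [L v, R v]` is an interval representation of `G` in which no interval properly
contains another one. -/
structure IsProperRep {n : ℕ} (G : SimpleGraph (Fin n)) (L R : Fin n → ℝ) : Prop where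
  le : ∀ v, L v ≤ R v
  adj_iff : ∀ u v, u ≠ v →
    (G.Adj u v ↔ (Set.Icc (L u) (R u) ∩ Set.Icc (L v) (R v)).Nonempty)
  proper : ∀ u v, ¬ Set.Icc (L u) (R u) ⊂ Set.Icc (L v) (R v)

/-- `G` is a proper interval graph. -/
def IsProperIntervalGraph {n : ℕ} (G : SimpleGraph (Fin n)) : Prop :=
  ∃ L R : Fin n → ℝ, IsProperRep G L R

/-- `σ 0, σ 1, …, σ (n - 1)` lists the vertices of `G` in the order of the intervals of some
proper representation: by left end point, ties by right end point. -/
def IsProperIntervalOrder {n : ℕ} (G : SimpleGraph (Fin n)) (σ : Equiv.Perm (Fin n)) : Prop :=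
  ∃ L R : Fin n → ℝ, IsProperRep G L R ∧
    ∀ i j : Fin n, i < j →
      L (σ i) < L (σ j) ∨ (L (σ i) = L (σ j) ∧ R (σ i) ≤ R (σ j))

/-! ### Equitable tree-colorings -/

/-- Each color class of `c` induces a forest, and the sizes of any two color classes (empty
ones included) differ by at most one. -/
structure IsEquitableTreeColoring {n k : ℕ} (G : SimpleGraph (Fin n)) (c : Fin n → Fin k) :
    Prop where
  forest : ∀ a : Fin k, (G.induce {v | c v = a}).IsAcyclic
  equitable : ∀ a b : Fin k, {v | c v = a}.ncard ≤ {v | c v = b}.ncard + 1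

/-- Some cycle of `G` has all its vertices in one color class of `c`. -/
def HasMonochromaticCycle {n k : ℕ} (G : SimpleGraph (Fin n)) (c : Fin n → Fin k) : Prop :=
  ∃ (a : Fin k) (v : Fin n) (p : G.Walk v v), p.IsCycle ∧ ∀ w ∈ p.support, c w = a

/-! ### The coloring algorithm -/

/-- The vertex in position `i` of the order `σ` gets the color `i` mod `k`. -/
def modColoring {n k : ℕ} (hk : 0 < k) (σ : Equiv.Perm (Fin n)) : Fin n → Fin k :=
  fun v => ⟨(σ.symm v : ℕ) % k, Nat.mod_lt _ hk⟩

open Classical in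
/-- The result of the algorithm once the vertices have been sorted as `σ 0, …, σ (n - 1)`: the
answer (`true` is YES, `false` is NO) and the coloring. -/
noncomputable def algorithmResult {n k : ℕ} (G : SimpleGraph (Fin n)) (hk : 0 < k)
    (σ : Equiv.Perm (Fin n)) : Bool × (Fin n → Fin k) :=
  (if HasMonochromaticCycle G (modColoring hk σ) then false else true, modColoring hk σ)

/-! ### The machine model

A random access machine with unit cost. A program uses finitely many scalar variables and
finitely many arrays, all with values in `ℕ`; array cells are accessed by a computed index. The
only arithmetic is adding or subtracting one, so that a computation of `t` steps raises the
largest number around by at most `t` above the largest number in the input and the program. -/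

/-- The memory: scalar variables `var x` and array cells `arr a i`. -/
structure Mem where
  var : ℕ → ℕ
  arr : ℕ → ℕ → ℕ

/-- Elementary instructions. The arguments `x`, `y` are names of variables and `a` is the name of
an array. -/
inductive Instr where
  /-- `x := m` for a literal `m` -/
  | lit (x m : ℕ)
  /-- `x := y` -/
  | copy (x y : ℕ)
  /-- `x := x + 1` -/
  | inc (x : ℕ)
  /-- `x := x - 1` (and `0` stays `0`) -/
  | dec (x : ℕ)
  /-- `x := a[y]` -/
  | load (x a y : ℕ)
  /-- `a[x] := y` -/
  | store (a x y : ℕ)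

/-- The effect of an elementary instruction. -/
def Instr.apply : Instr → Mem → Mem
  | .lit x m, s => { s with var := Function.update s.var x m }
  | .copy x y, s => { s with var := Function.update s.var x (s.var y) }
  | .inc x, s => { s with var := Function.update s.var x (s.var x + 1) }
  | .dec x, s => { s with var := Function.update s.var x (s.var x - 1) }
  | .load x a y, s => { s with var := Function.update s.var x (s.arr a (s.var y)) }
  | .store a x y, s =>
    { s with arr := Function.update s.arr a (Function.update (s.arr a) (s.var x) (s.var y)) }

/-- Comparisons of two variables. -/
inductive Test where
  | eq (x y : ℕ)
  | ne (x y : ℕ)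
  | lt (x y : ℕ)
  | le (x y : ℕ)

/-- When a comparison succeeds. -/
def Test.Holds : Test → Mem → Prop
  | .eq x y, s => s.var x = s.var y
  | .ne x y, s => s.var x ≠ s.var y
  | .lt x y, s => s.var x < s.var y
  | .le x y, s => s.var x ≤ s.var y

/-- Programs. -/
inductive Prog where
  | instr (i : Instr)
  | seq (p q : Prog)
  | cond (b : Test) (p q : Prog)
  | loop (b : Test) (p : Prog)

/-- `Exec p s t s'`: started in memory `s`, the program `p` halts after exactly `t` steps in memory
`s'`, where a step is the execution of one elementary instruction or one comparison. -/
inductive Exec : Prog → Mem → ℕ → Mem → Prop where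
  | instr (i : Instr) (s : Mem) : Exec (.instr i) s 1 (i.apply s)
  | seq {p q : Prog} {s s' s'' : Mem} {t t' : ℕ} :
      Exec p s t s' → Exec q s' t' s'' → Exec (.seq p q) s (t + t') s''
  | cond_true {b : Test} {p q : Prog} {s s' : Mem} {t : ℕ} :
      b.Holds s → Exec p s t s' → Exec (.cond b p q) s (t + 1) s'
  | cond_false {b : Test} {p q : Prog} {s s' : Mem} {t : ℕ} :
      ¬ b.Holds s → Exec q s t s' → Exec (.cond b p q) s (t + 1) s'
  | loop_done {b : Test} {p : Prog} {s : Mem} :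
      ¬ b.Holds s → Exec (.loop b p) s 1 s
  | loop_step {b : Test} {p : Prog} {s s' s'' : Mem} {t t' : ℕ} :
      b.Holds s → Exec p s t s' → Exec (.loop b p) s' t' s'' →
      Exec (.loop b p) s (t + t' + 1) s''

/-! ### Input and output -/

/-- Adjacency lists of `G`: the neighbors of each vertex, each once, in an arbitrary order. -/
structure AdjLists {n : ℕ} (G : SimpleGraph (Fin n)) where
  nbrs : Fin n → List (Fin n)
  nodup : ∀ v, (nbrs v).Nodup
  mem_nbrs : ∀ v w, w ∈ nbrs v ↔ G.Adj v w

/-- The concatenation of the adjacency lists of `0, 1, …, n - 1`. -/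
def AdjLists.flat {n : ℕ} {G : SimpleGraph (Fin n)} (A : AdjLists G) : List (Fin n) :=
  (List.finRange n).flatMap A.nbrs

/-- The total length of the adjacency lists of the first `i` vertices, that is, the position in
`A.flat` at which the list of vertex `i` starts. -/
def AdjLists.offset {n : ℕ} {G : SimpleGraph (Fin n)} (A : AdjLists G) (i : ℕ) : ℕ :=
  (((List.finRange n).take i).map fun v => (A.nbrs v).length).sum

/-- The initial memory. Variable 0 holds the number of vertices and variable 1 the number of
colors; cells `0, …, n` of array 0 hold the offsets of the adjacency lists, and array 1 holds
their concatenation. Everything else is `0`. -/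
def AdjLists.input {n : ℕ} {G : SimpleGraph (Fin n)} (A : AdjLists G) (k : ℕ) : Mem where
  var := fun x => if x = 0 then n else if x = 1 then k else 0
  arr := fun a i =>
    if a = 0 then (if i ≤ n then A.offset i else 0)
    else if a = 1 then (A.flat.map Fin.val).getD i 0
    else 0

/-- The output `s` gives the answer `ans` in variable 2: `1` for YES and `0` for NO. -/
def Mem.Answers (s : Mem) (ans : Bool) : Prop :=
  s.var 2 = if ans then 1 else 0

/-- The output `s` lists the vertices in the order `σ`, in array 2. -/
def Mem.ListsOrder (s : Mem) {n : ℕ} (σ : Equiv.Perm (Fin n)) : Prop :=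
  ∀ i : Fin n, s.arr 2 i = σ i

/-- The output `s` gives the coloring `c`, in array 3. -/
def Mem.GivesColoring (s : Mem) {n k : ℕ} (c : Fin n → Fin k) : Prop :=
  ∀ v : Fin n, s.arr 3 v = c v

end EquitableTree

open EquitableTree

/-! Correctness. Proper interval orders are exactly the umbrella orders: if the first and the last
of three vertices are adjacent, then the middle one is adjacent to both
(`IsProperIntervalOrder.isUmbrella`, `IsUmbrella.isProperIntervalOrder`). In such an order the
cyclic coloring has a monochromatic cycle if and only if two vertices exactly `2 * k` places apart
are adjacent (`hasMonochromaticCycle_iff`). Such a pair spans a clique of `2 * k + 1` consecutive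
vertices, so by pigeonhole every `k`-coloring has a monochromatic triangle (`not_forest_of_adj`).
Hence a failure of the cyclic coloring is a failure of all colorings. Its classes are residue
classes of positions, so it is always equitable.

Linear time. An umbrella order is found by two breadth-first sweeps in which the vertices discovered
from a common neighbor are sorted by degree. The first sweep prefers large degrees; the last vertex
of each component then lies at an end of an umbrella order, up to twins, that is, vertices with
equal closed neighborhoods (`twin_of_last`, `exists_isEnd`). The second sweep takes its sources from
the reversed first order, so it enters each component at such an end, and it prefers small degrees;
it then follows an umbrella order up to the exchange of twins (`lt_or_twin`), which does no harm. In
both arguments the umbrella property gives an inclusion of closed neighborhoods, and the degree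
comparison turns it into equality (`twin_of_subset`).

The sorting by degree stays linear because a vertex of degree `d` is looked at in `d + 1` rounds and
enters the queue once, for a total of `2|E| + |V|`. The answer needs no search for cycles: only the
pairs at distance `2 * k` are tested. Running times are proved with `Runs`, which treats the steps
left as a budget; loop invariants bound the spent part of the budget by a potential. -/

namespace EquitableTree

/-! ### Umbrella orders -/

/-- The injective ranking `r` of the vertices is an umbrella order of `G`: any vertex ranked
between two adjacent ones is adjacent to both. -/
structure IsUmbrella {V : Type*} (G : SimpleGraph V) (r : V → ℤ) : Prop where
  inj : Function.Injective r
  adj : ∀ a b c, r a < r b → r b < r c → G.Adj a c → G.Adj a b ∧ G.Adj b c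

/-- Reversal by negation is what rankings with values in `ℤ`, rather than `ℕ`, are good for. -/
theorem IsUmbrella.neg {V : Type*} {G : SimpleGraph V} {r : V → ℤ} (h : IsUmbrella G r) :
    IsUmbrella G (fun v => -r v) where
  inj := fun a b hab => h.inj (neg_injective hab)
  adj := fun a b c hab hbc hac =>
    have := h.adj c b a (by simpa using hbc) (by simpa using hab) hac.symm
    ⟨this.2.symm, this.1.symm⟩

/-- The ranking of the vertices by their positions in `σ`. -/
def rank {n : ℕ} (σ : Equiv.Perm (Fin n)) (v : Fin n) : ℤ := (σ.symm v : ℕ)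

theorem rank_injective {n : ℕ} (σ : Equiv.Perm (Fin n)) : Function.Injective (rank σ) := by
  intro a b h
  exact σ.symm.injective (Fin.ext (by simpa [rank] using h))

theorem IsProperRep.right_lt {n : ℕ} {G : SimpleGraph (Fin n)} {L R : Fin n → ℝ}
    (h : IsProperRep G L R) {u v : Fin n} (huv : L u < L v) : R u < R v := by
  by_contra! hle
  refine h.proper v u ⟨Set.Icc_subset_Icc huv.le hle, fun hsub => ?_⟩
  exact absurd (hsub ⟨le_rfl, h.le u⟩).1 (not_le.2 huv)

/-- Along the order both end points increase weakly. If the intervals of `a` and `c` meet, then `L c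
≤ R a`, so `L b` lies in the interval of `a` and `L c` in that of `b`. -/
theorem IsProperIntervalOrder.isUmbrella {n : ℕ} {G : SimpleGraph (Fin n)}
    {σ : Equiv.Perm (Fin n)} (h : IsProperIntervalOrder G σ) : IsUmbrella G (rank σ) := by
  obtain ⟨L, R, hrep, hord⟩ := h
  have key : ∀ a b, rank σ a < rank σ b → L a ≤ L b ∧ R a ≤ R b := by
    intro a b hab
    have := hord (σ.symm a) (σ.symm b) (by simpa [rank] using hab)
    simp only [Equiv.apply_symm_apply] at this
    rcases this with h1 | ⟨h1, h2⟩
    · exact ⟨h1.le, (hrep.right_lt h1).le⟩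
    · exact ⟨h1.le, h2⟩
  refine ⟨rank_injective σ, fun a b c hab hbc hac => ?_⟩
  have h1 := key a b hab
  have h2 := key b c hbc
  obtain ⟨x, hxa, hxc⟩ := (hrep.adj_iff a c hac.ne).1 hac
  have hab' : a ≠ b := by rintro rfl; exact lt_irrefl _ hab
  have hbc' : b ≠ c := by rintro rfl; exact lt_irrefl _ hbc
  have hx := hxc.1.trans hxa.2
  exact ⟨(hrep.adj_iff a b hab').2 ⟨L b, ⟨h1.1, h2.1.trans hx⟩, ⟨le_rfl, hrep.le b⟩⟩,
    (hrep.adj_iff b c hbc').2 ⟨L c, ⟨h2.1, hx.trans h1.2⟩, ⟨le_rfl, hrep.le c⟩⟩⟩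

open Classical in
/-- The largest position of a vertex in the closed neighborhood of `v`. -/
noncomputable def lastPos {n : ℕ} (G : SimpleGraph (Fin n)) (σ : Equiv.Perm (Fin n))
    (v : Fin n) : ℕ :=
  (Finset.univ.filter fun w => w = v ∨ G.Adj v w).sup fun w => (σ.symm w : ℕ)

theorem le_lastPos {n : ℕ} (G : SimpleGraph (Fin n)) (σ : Equiv.Perm (Fin n)) {v w : Fin n}
    (h : w = v ∨ G.Adj v w) : (σ.symm w : ℕ) ≤ lastPos G σ v := by
  classical
  exact Finset.le_sup (f := fun w => (σ.symm w : ℕ)) (by simpa using h)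

theorem exists_lastPos_eq {n : ℕ} (G : SimpleGraph (Fin n)) (σ : Equiv.Perm (Fin n))
    (v : Fin n) : ∃ w, (w = v ∨ G.Adj v w) ∧ lastPos G σ v = (σ.symm w : ℕ) := by
  classical
  obtain ⟨w, hw, hw'⟩ := Finset.exists_mem_eq_sup
    (Finset.univ.filter fun w => w = v ∨ G.Adj v w) ⟨v, by simp⟩ fun w => (σ.symm w : ℕ)
  exact ⟨w, by simpa using hw, hw'⟩

/-- The interval of `v` runs from its position to the last position in its closed neighborhood,
which is weakly monotone by the umbrella property. The right end is shifted by `ε v`: strictly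
increasing in the position, so that no interval contains another, and below 1, so that no further
integer left end is reached. -/
theorem IsUmbrella.isProperIntervalOrder {n : ℕ} {G : SimpleGraph (Fin n)}
    {σ : Equiv.Perm (Fin n)} (h : IsUmbrella G (rank σ)) : IsProperIntervalOrder G σ := by
  have hadj : ∀ a b c : Fin n, σ.symm a < σ.symm b → σ.symm b < σ.symm c → G.Adj a c →
      G.Adj a b ∧ G.Adj b c := fun a b c hab hbc =>
    h.adj a b c (by simpa [rank] using hab) (by simpa [rank] using hbc)
  have hself : ∀ v, (σ.symm v : ℕ) ≤ lastPos G σ v := fun v => le_lastPos G σ (Or.inl rfl)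
  have hmono : ∀ u v, σ.symm u < σ.symm v → lastPos G σ u ≤ lastPos G σ v := by
    intro u v huv
    obtain ⟨w, hw, hw'⟩ := exists_lastPos_eq G σ u
    rw [hw']
    rcases lt_or_ge (σ.symm v) (σ.symm w) with hvw | hvw
    · rcases hw with rfl | hw
      · exact absurd (huv.trans hvw) (lt_irrefl _)
      · exact le_lastPos G σ (Or.inr (hadj u v w huv hvw hw).2)
    · exact le_trans hvw (hself v)
  have hle : ∀ u v, σ.symm u < σ.symm v → (G.Adj u v ↔ (σ.symm v : ℕ) ≤ lastPos G σ u) := by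
    intro u v huv
    refine ⟨fun h => le_lastPos G σ (Or.inr h), fun h => ?_⟩
    obtain ⟨w, hw, hw'⟩ := exists_lastPos_eq G σ u
    rw [hw'] at h
    have huw : σ.symm u < σ.symm w := lt_of_lt_of_le huv h
    rcases hw with rfl | hw
    · exact absurd huw (lt_irrefl _)
    · rcases (show σ.symm v ≤ σ.symm w from h).eq_or_lt with e | hvw
      · rwa [σ.symm.injective e]
      · exact (hadj u v w huv hvw hw).1
  set L : Fin n → ℝ := fun v => ((σ.symm v : ℕ) : ℝ) with hL
  set ε : Fin n → ℝ := fun v => ((σ.symm v : ℕ) : ℝ) / (n + 1) with hε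
  set R : Fin n → ℝ := fun v => (lastPos G σ v : ℝ) + ε v with hR
  have hn : (0 : ℝ) < n + 1 := by positivity
  have hε0 : ∀ v, 0 ≤ ε v := fun v => by simp only [hε]; positivity
  have hε1 : ∀ v, ε v < 1 := fun v => by
    simp only [hε]
    rw [div_lt_one hn]
    exact_mod_cast (σ.symm v).2.trans (Nat.lt_succ_self n)
  have hεlt : ∀ u v, σ.symm u < σ.symm v → ε u < ε v := fun u v huv => by
    simp only [hε]
    gcongr
    exact_mod_cast huv
  have hLlt : ∀ u v, σ.symm u < σ.symm v → L u < L v := fun u v huv => by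
    simp only [hL]
    exact_mod_cast huv
  have hRlt : ∀ u v, σ.symm u < σ.symm v → R u < R v := fun u v huv =>
    add_lt_add_of_le_of_lt (by exact_mod_cast hmono u v huv) (hεlt u v huv)
  have hLR : ∀ v, L v ≤ R v := fun v => by
    have : L v ≤ (lastPos G σ v : ℝ) := by simp only [hL]; exact_mod_cast hself v
    exact this.trans (le_add_of_nonneg_right (hε0 v))
  have hmeet : ∀ u v, σ.symm u < σ.symm v →
      (G.Adj u v ↔ (Set.Icc (L u) (R u) ∩ Set.Icc (L v) (R v)).Nonempty) := by
    intro u v huv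
    rw [hle u v huv]
    constructor
    · intro hv
      refine ⟨L v, ⟨(hLlt u v huv).le, ?_⟩, le_rfl, hLR v⟩
      have : L v ≤ (lastPos G σ u : ℝ) := by simp only [hL]; exact_mod_cast hv
      exact this.trans (le_add_of_nonneg_right (hε0 u))
    · rintro ⟨x, hxu, hxv⟩
      have h1 : L v ≤ R u := hxv.1.trans hxu.2
      have h2 : ((σ.symm v : ℕ) : ℝ) < lastPos G σ u + 1 :=
        lt_of_le_of_lt h1 (add_lt_add_of_le_of_lt le_rfl (hε1 u))
      exact Nat.lt_succ_iff.1 (by exact_mod_cast h2)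
  refine ⟨L, R, ⟨hLR, fun u v huv => ?_, fun u v huv => ?_⟩, fun i j hij => Or.inl ?_⟩
  · rcases lt_or_gt_of_ne (fun e => huv (σ.symm.injective e)) with hlt | hlt
    · exact hmeet u v hlt
    · rw [G.adj_comm, Set.inter_comm]
      exact hmeet v u hlt
  · have hne : σ.symm u ≠ σ.symm v := by
      intro e
      rw [σ.symm.injective e] at huv
      exact huv.2 subset_rfl
    have h1 := huv.1 ⟨le_rfl, hLR u⟩
    have h2 := huv.1 ⟨hLR u, le_rfl⟩
    rcases lt_or_gt_of_ne hne with hlt | hlt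
    · exact absurd h1.1 (not_le.2 (hLlt u v hlt))
    · exact absurd h2.2 (not_le.2 (hRlt v u hlt))
  · exact hLlt _ _ (by simpa using hij)

theorem IsProperIntervalGraph.exists_isUmbrella {n : ℕ} {G : SimpleGraph (Fin n)}
    (h : IsProperIntervalGraph G) : ∃ r : Fin n → ℤ, IsUmbrella G r := by
  obtain ⟨L, R, hrep⟩ := h
  let key : Fin n → ℝ ×ₗ ℝ := fun v => toLex (L v, R v)
  refine ⟨rank (Tuple.sort key), IsProperIntervalOrder.isUmbrella ⟨L, R, hrep, ?_⟩⟩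
  intro i j hij
  have := Tuple.monotone_sort key hij.le
  simpa [key, Prod.Lex.le_iff] using this

/-! ### Correctness of the coloring -/

theorem isCycle_triangle {V : Type*} {G : SimpleGraph V} {a b c : V} (hab : G.Adj a b)
    (hbc : G.Adj b c) (hca : G.Adj c a) :
    (SimpleGraph.Walk.cons hab (.cons hbc (.cons hca .nil))).IsCycle := by
  have h1 := hab.ne
  have h2 := hbc.ne
  have h3 := hca.ne
  rw [SimpleGraph.Walk.isCycle_def]
  simp only [SimpleGraph.Walk.isTrail_def]
  simp
  tauto

/-- The first vertex of a monochromatic cycle has two neighbors on the cycle, both later and in its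
own residue class mod `k`, so the farther one is at least `2 * k` places away; the umbrella property
brings this down to exactly `2 * k`. Conversely, the positions `i`, `i + k`, `i + 2 * k` form a
triangle. -/
theorem hasMonochromaticCycle_iff {n k : ℕ} {G : SimpleGraph (Fin n)} {hk : 0 < k}
    {σ : Equiv.Perm (Fin n)} (hσ : IsUmbrella G (rank σ)) :
    HasMonochromaticCycle G (modColoring hk σ) ↔
      ∃ i j : Fin n, (j : ℕ) = i + 2 * k ∧ G.Adj (σ i) (σ j) := by
  have hadj : ∀ i j l : Fin n, i < j → j < l → G.Adj (σ i) (σ l) →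
      G.Adj (σ i) (σ j) ∧ G.Adj (σ j) (σ l) := fun i j l hij hjl =>
    hσ.adj _ _ _ (by simpa [rank] using hij) (by simpa [rank] using hjl)
  constructor
  · rintro ⟨a, v, p, hp, hsupp⟩
    obtain ⟨w, hw, hmin⟩ := Finset.exists_min_image p.support.toFinset
      (fun x => (σ.symm x : ℕ)) ⟨v, by simp⟩
    simp only [List.mem_toFinset] at hw hmin
    have hcard := hp.ncard_neighborSet_toSubgraph_eq_two hw
    obtain ⟨x, y, hxy, hset⟩ := Set.ncard_eq_two.1 hcard
    have key : ∀ x, x ∈ p.toSubgraph.neighborSet w → G.Adj w x ∧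
        (σ.symm w : ℕ) < σ.symm x ∧ (σ.symm x : ℕ) % k = (σ.symm w : ℕ) % k := by
      intro x hx
      have hwx : p.toSubgraph.Adj w x := hx
      have hxs : x ∈ p.support := by
        rw [← SimpleGraph.Walk.mem_verts_toSubgraph]
        exact hwx.snd_mem
      refine ⟨hwx.adj_sub, lt_of_le_of_ne (hmin x hxs) fun e => ?_, ?_⟩
      · exact hwx.adj_sub.ne (σ.symm.injective (Fin.ext e))
      · have := (hsupp x hxs).trans (hsupp w hw).symm
        simpa [modColoring] using this
    obtain ⟨hx1, hx2, hx3⟩ := key x (by rw [hset]; simp)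
    obtain ⟨hy1, hy2, hy3⟩ := key y (by rw [hset]; simp)
    have hne : (σ.symm x : ℕ) ≠ σ.symm y := fun e => hxy (σ.symm.injective (Fin.ext e))
    have step : ∀ p q : ℕ, p < q → q % k = p % k → p + k ≤ q := fun p q hpq he => by
      have := Nat.le_of_dvd (by omega) ((Nat.modEq_iff_dvd' hpq.le).1 he.symm)
      omega
    have main : ∀ x, G.Adj w x → (σ.symm w : ℕ) + 2 * k ≤ σ.symm x →
        ∃ i j : Fin n, (j : ℕ) = i + 2 * k ∧ G.Adj (σ i) (σ j) := by
      intro x hwx hle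
      refine ⟨σ.symm w, ⟨σ.symm w + 2 * k, hle.trans_lt (σ.symm x).2⟩, rfl, ?_⟩
      rcases hle.eq_or_lt with e | hlt
      · have : (⟨σ.symm w + 2 * k, hle.trans_lt (σ.symm x).2⟩ : Fin n) = σ.symm x := Fin.ext e
        simpa [this] using hwx
      · exact (hadj _ _ (σ.symm x) (Fin.lt_def.2 (by simp only; omega)) (Fin.lt_def.2 hlt)
          (by simpa using hwx)).1
    have sx := step _ _ hx2 hx3
    have sy := step _ _ hy2 hy3
    rcases lt_or_gt_of_ne hne with hlt | hlt
    · exact main y hy1 (by have := step _ _ hlt (hy3.trans hx3.symm); omega)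
    · exact main x hx1 (by have := step _ _ hlt (hx3.trans hy3.symm); omega)
  · rintro ⟨i, l, hil, h⟩
    have hlt : (i : ℕ) + k < n := by have := l.2; omega
    have h1 := hadj i ⟨i + k, hlt⟩ l (Fin.lt_def.2 (by simp only; omega))
      (Fin.lt_def.2 (by simp only; omega)) h
    refine ⟨⟨i % k, Nat.mod_lt _ hk⟩, _, _, isCycle_triangle h1.1 h1.2 h.symm, ?_⟩
    have h2 : (l : ℕ) % k = i % k := by rw [hil, Nat.add_mul_mod_self_right]
    simp [modColoring, h2]

/-- All positions from `i` to `l` form a clique of `2 * k + 1` vertices, three of which share a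
color and form a triangle. -/
theorem not_forest_of_adj {n k : ℕ} {G : SimpleGraph (Fin n)} {σ : Equiv.Perm (Fin n)}
    (hσ : IsUmbrella G (rank σ)) {i l : Fin n} (hil : (l : ℕ) = i + 2 * k)
    (h : G.Adj (σ i) (σ l)) (c : Fin n → Fin k) :
    ¬ ∀ a : Fin k, (G.induce {v | c v = a}).IsAcyclic := by
  intro hforest
  have hadj : ∀ i j l : Fin n, i < j → j < l → G.Adj (σ i) (σ l) →
      G.Adj (σ i) (σ j) ∧ G.Adj (σ j) (σ l) := fun i j l hij hjl =>
    hσ.adj _ _ _ (by simpa [rank] using hij) (by simpa [rank] using hjl)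
  have hclique : ∀ x ∈ Finset.Icc i l, ∀ y ∈ Finset.Icc i l, x ≠ y → G.Adj (σ x) (σ y) := by
    have hlt : ∀ x ∈ Finset.Icc i l, ∀ y ∈ Finset.Icc i l, x < y → G.Adj (σ x) (σ y) := by
      intro x hx y hy hxy
      rw [Finset.mem_Icc] at hx hy
      have h1 : G.Adj (σ i) (σ y) := by
        rcases hy.2.eq_or_lt with rfl | hyl
        · exact h
        · exact (hadj i y l (hx.1.trans_lt hxy) hyl h).1
      rcases hx.1.eq_or_lt with rfl | hix
      · exact h1
      · exact (hadj i x y hix hxy h1).2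
    intro x hx y hy hxy
    rcases lt_or_gt_of_ne hxy with h1 | h1
    · exact hlt x hx y hy h1
    · exact (hlt y hy x hx h1).symm
  obtain ⟨a, -, ha⟩ := Finset.exists_lt_card_fiber_of_mul_lt_card_of_maps_to
    (s := Finset.Icc i l) (t := (Finset.univ : Finset (Fin k))) (f := fun x => c (σ x)) (n := 2)
    (fun _ _ => Finset.mem_univ _) (by simp [Fin.card_Icc]; omega)
  obtain ⟨x, hx, y, hy, z, hz, hxy, hxz, hyz⟩ := Finset.two_lt_card.1 ha
  rw [Finset.mem_filter] at hx hy hz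
  refine hforest a _ (isCycle_triangle (G := G.induce {v | c v = a}) (a := ⟨σ x, hx.2⟩)
    (b := ⟨σ y, hy.2⟩) (c := ⟨σ z, hz.2⟩) ?_ ?_ ?_)
  · exact hclique x hx.1 y hy.1 hxy
  · exact hclique y hy.1 z hz.1 hyz
  · exact hclique z hz.1 x hx.1 hxz.symm

theorem ncard_modColoring {n k : ℕ} (hk : 0 < k) (σ : Equiv.Perm (Fin n)) (a : Fin k) :
    {v | modColoring hk σ v = a}.ncard = n / k + if (a : ℕ) < n % k then 1 else 0 := by
  have h := Nat.count_modEq_card n hk a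
  rw [Nat.mod_eq_of_lt a.2] at h
  rw [← h, Nat.count_eq_card_filter_range, ← Set.ncard_coe_finset]
  refine Set.ncard_congr (fun v _ => (σ.symm v : ℕ)) ?_ ?_ ?_
  · intro v hv
    simp only [modColoring, Set.mem_ofPred_eq, Fin.ext_iff] at hv
    simp [Nat.ModEq, hv, Nat.mod_eq_of_lt a.2]
  · intro v w _ _ e
    exact σ.symm.injective (Fin.ext e)
  · intro i hi
    simp only [Finset.coe_filter, Finset.mem_range, Set.mem_ofPred_eq] at hi
    refine ⟨σ ⟨i, hi.1⟩, ?_, by simp⟩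
    have := hi.2
    simp only [Nat.ModEq, Nat.mod_eq_of_lt a.2] at this
    simp [modColoring, Fin.ext_iff, this]

theorem isEquitableTreeColoring_modColoring {n k : ℕ} {G : SimpleGraph (Fin n)} (hk : 0 < k)
    (σ : Equiv.Perm (Fin n)) (h : ¬ HasMonochromaticCycle G (modColoring hk σ)) :
    IsEquitableTreeColoring G (modColoring hk σ) := by
  refine ⟨fun a v p hp => h ?_, fun a b => ?_⟩
  · let f := SimpleGraph.Embedding.induce (G := G) {v | modColoring hk σ v = a}
    refine ⟨a, _, p.map f.toHom, hp.map f.injective, ?_⟩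
    intro w hw
    rw [SimpleGraph.Walk.support_map, List.mem_map] at hw
    obtain ⟨x, -, rfl⟩ := hw
    exact x.2
  · rw [ncard_modColoring, ncard_modColoring]
    split_ifs <;> omega

theorem algorithmResult_fst_eq_true_iff {n k : ℕ} {G : SimpleGraph (Fin n)} {hk : 0 < k}
    {σ : Equiv.Perm (Fin n)} :
    (algorithmResult G hk σ).1 = true ↔ ¬ HasMonochromaticCycle G (modColoring hk σ) := by
  simp [algorithmResult]

theorem algorithmResult_correct {n k : ℕ} {G : SimpleGraph (Fin n)} (hk : 0 < k)
    {σ : Equiv.Perm (Fin n)} (hσ : IsUmbrella G (rank σ)) :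
    ((algorithmResult G hk σ).1 = true ↔
      ∃ c : Fin n → Fin k, IsEquitableTreeColoring G c) ∧
    ((algorithmResult G hk σ).1 = true →
      IsEquitableTreeColoring G (algorithmResult G hk σ).2) := by
  have h2 : (algorithmResult G hk σ).1 = true →
      IsEquitableTreeColoring G (algorithmResult G hk σ).2 := fun h =>
    isEquitableTreeColoring_modColoring hk σ (algorithmResult_fst_eq_true_iff.1 h)
  refine ⟨⟨fun h => ⟨_, h2 h⟩, ?_⟩, h2⟩
  rintro ⟨c, hc⟩
  rw [algorithmResult_fst_eq_true_iff, hasMonochromaticCycle_iff hσ]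
  rintro ⟨i, j, hij, h⟩
  exact not_forest_of_adj hσ hij h c hc.forest

/-! ### Breadth-first search in graphs with an umbrella order -/

section Bfs

variable {V : Type*} {G : SimpleGraph V}

/-- `x` lies in the closed neighborhood of `a`. -/
def ClosedNbr (G : SimpleGraph V) (a x : V) : Prop := x = a ∨ G.Adj a x

/-- `a` and `b` have the same closed neighborhood. -/
def Twin (G : SimpleGraph V) (a b : V) : Prop := ∀ x, ClosedNbr G a x ↔ ClosedNbr G b x

theorem ClosedNbr.adj {a x : V} (h : ClosedNbr G a x) (hne : x ≠ a) : G.Adj a x :=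
  h.resolve_left hne

theorem Twin.adj {a b : V} (h : Twin G a b) (hne : a ≠ b) : G.Adj a b :=
  ((h b).2 (Or.inl rfl)).adj hne.symm

theorem Twin.adj_right {a b x : V} (h : Twin G a b) (ha : G.Adj a x) (hne : x ≠ b) : G.Adj b x :=
  ((h x).1 (Or.inr ha)).adj hne

theorem Twin.symm {a b : V} (h : Twin G a b) : Twin G b a := fun x => (h x).symm

/-- A closed neighborhood has one element more than the degree, so the inclusion is between finite
sets with the reverse comparison of sizes. This is the only use of the degree tie-breaking. -/
theorem twin_of_subset [Finite V] {a b : V} (h : ∀ x, ClosedNbr G b x → ClosedNbr G a x)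
    (hd : (G.neighborSet a).ncard ≤ (G.neighborSet b).ncard) : Twin G a b := by
  have hset : ∀ v, {x | ClosedNbr G v x} = insert v (G.neighborSet v) := fun v => by
    ext x; simp [ClosedNbr]
  have hcard : ∀ v, {x | ClosedNbr G v x}.ncard = (G.neighborSet v).ncard + 1 := fun v => by
    rw [hset, Set.ncard_insert_of_notMem (by simp)]
  have heq : {x | ClosedNbr G b x} = {x | ClosedNbr G a x} :=
    Set.eq_of_subset_of_ncard_le h (by rw [hcard, hcard]; omega)
  intro x
  exact (Set.ext_iff.1 heq x).symm

/-- `z` comes first in its component in the ranking `r`, up to twins. -/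
def IsEnd (G : SimpleGraph V) (r : V → ℤ) (z : V) : Prop :=
  ∀ x, G.Reachable z x → r z ≤ r x ∨ Twin G z x

/-- The injective numbering `pos` of the vertices is a breadth-first search order, `m a` is the
least position in the closed neighborhood of `a`, and the vertices first seen from a common
neighbor are ordered by degree, with respect to `R`. -/
structure IsBfsOrder (G : SimpleGraph V) (R : ℕ → ℕ → Prop) (pos m : V → ℕ) : Prop where
  inj : Function.Injective pos
  le : ∀ a, m a ≤ pos a
  parent : ∀ a, m a < pos a → ∃ p, pos p = m a ∧ G.Adj p a
  first : ∀ x a, G.Adj x a → m a ≤ pos x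
  mono : ∀ a b, pos a < pos b → m a ≤ m b
  tie : ∀ a b, pos a < pos b → m a = m b → m a < pos a →
    R (G.neighborSet a).ncard (G.neighborSet b).ncard

namespace IsBfsOrder

variable {R : ℕ → ℕ → Prop} {pos m : V → ℕ}

/-- The positions from a source on are closed under adjacency: by monotonicity of `m`, a later
vertex has no neighbor before the source. -/
theorem le_pos_of_reachable (h : IsBfsOrder G R pos m) {s : V} (hs : m s = pos s) {y x : V}
    (hy : pos s ≤ pos y) (hyx : G.Reachable y x) : pos s ≤ pos x := by
  obtain ⟨p⟩ := hyx
  induction p with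
  | nil => exact hy
  | @cons u v w huv _ ih =>
    refine ih ?_
    have h1 : m u ≤ pos v := h.first v u huv.symm
    have h2 : pos s ≤ m u := by
      rcases hy.eq_or_lt with e | hlt
      · rw [← h.inj e, hs]
      · exact hs ▸ h.mono s u hlt
    exact h2.trans h1

theorem source_unique (h : IsBfsOrder G R pos m) {s t : V} (hs : m s = pos s) (ht : m t = pos t)
    (hst : G.Reachable s t) : s = t :=
  h.inj (le_antisymm (h.le_pos_of_reachable hs le_rfl hst)
    (h.le_pos_of_reachable ht le_rfl hst.symm))

theorem exists_source (h : IsBfsOrder G R pos m) (a : V) :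
    ∃ s, m s = pos s ∧ G.Reachable s a := by
  induction hk : pos a using Nat.strong_induction_on generalizing a with
  | _ k ih =>
    rcases (h.le a).eq_or_lt with e | hlt
    · exact ⟨a, e, .rfl⟩
    · obtain ⟨p, hp, hpa⟩ := h.parent a hlt
      obtain ⟨s, hs, hsp⟩ := ih (pos p) (by omega) p rfl
      exact ⟨s, hs, hsp.trans hpa.reachable⟩

/-- Each component occupies consecutive positions: the sources of `a` and of `b` bound each other
from below, hence coincide. -/
theorem reachable_of_between (h : IsBfsOrder G R pos m) {a b c : V} (hab : pos a < pos b)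
    (hbc : pos b < pos c) (hac : G.Reachable a c) : G.Reachable a b := by
  obtain ⟨s, hs, hsa⟩ := h.exists_source a
  obtain ⟨t, ht, htb⟩ := h.exists_source b
  have hsa' := h.le_pos_of_reachable hs le_rfl hsa
  have htb' := h.le_pos_of_reachable ht le_rfl htb
  have hta : pos t ≤ pos a := h.le_pos_of_reachable ht (by omega) hac.symm
  have hts : pos t ≤ pos s := h.le_pos_of_reachable ht hta hsa.symm
  have hst : pos s ≤ pos t := h.le_pos_of_reachable hs (by omega : pos s ≤ pos b) htb.symm
  have : s = t := h.inj (le_antisymm hst hts)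
  subst this
  exact hsa.symm.trans htb

/-- Parents are followed from `a` back towards `s`. The first edge that reaches or jumps over `b`
starts at `b` itself or at a neighbor of `b`, and positions only decrease along the way. -/
theorem min_le_min_of_right (h : IsBfsOrder G R pos m) {r : V → ℤ} (hr : IsUmbrella G r) {s : V}
    (hs : m s = pos s) {a b : V} (hsa : G.Reachable s a) (hsb : r s ≤ r b) (hba : r b < r a) :
    m b ≤ m a := by
  induction hk : pos a using Nat.strong_induction_on generalizing a with
  | _ k ih =>
    rcases (h.le a).eq_or_lt with e | hlt
    · have := h.source_unique hs e hsa
      subst this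
      omega
    · obtain ⟨p, hp, hpa⟩ := h.parent a hlt
      rw [← hp]
      rcases lt_trichotomy (r p) (r b) with h1 | h1 | h1
      · exact h.first p b (hr.adj p b a h1 hba hpa).1
      · rw [hr.inj h1]
        exact h.le b
      · exact (ih (pos p) (by omega) (hsa.trans hpa.symm.reachable) h1 rfl).trans (h.le p)

/-- In a breadth-first search that prefers large degrees, the last vertex of a component is at an
end of every umbrella order of it, up to twins. -/
theorem twin_of_last [Finite V] (h : IsBfsOrder G (· ≥ ·) pos m) {r : V → ℤ}
    (hr : IsUmbrella G r) {s z : V} (hs : m s = pos s) (hsz : G.Reachable s z) (hrsz : r s ≤ r z)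
    (hz : ∀ x, G.Reachable z x → pos x ≤ pos z) {x : V} (hx : G.Reachable z x)
    (hzx : r z < r x) : Twin G z x := by
  -- It suffices to show that `z` and the rightmost vertex `e` of the component are twins; the
  -- vertices between them follow.
  obtain ⟨e, hze, hmax⟩ := Set.exists_max_image {x | G.Reachable z x} r (Set.toFinite _) ⟨z, .rfl⟩
  have hze' : r z < r e := hzx.trans_le (hmax x hx)
  have hpos : pos e < pos z :=
    lt_of_le_of_ne (hz e hze) fun he => by rw [h.inj he] at hze'; exact lt_irrefl _ hze'
  -- `e` comes before `z` in the search, while `z` lies between the source and `e` in the umbrella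
  -- order: this gives the two inequalities.
  have hm : m e = m z :=
    le_antisymm (h.mono e z hpos) (h.min_le_min_of_right hr hs (hsz.trans hze) hrsz hze')
  have hlt : m e < pos e := lt_of_le_of_ne (h.le e) fun he => by
    have := h.source_unique hs he (hsz.trans hze)
    subst this
    omega
  obtain ⟨p, hp, hpe⟩ := h.parent e hlt
  -- The parent `p` of `e` is not to the right of `z`: otherwise `m z ≤ m p` would make `p` a
  -- source, hence equal to `s`, which is not to the right of `z`.
  have hadj : G.Adj z e := by
    rcases lt_trichotomy (r p) (r z) with h1 | h1 | h1
    · exact (hr.adj p z e h1 hze' hpe).2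
    · rwa [← hr.inj h1]
    · have hsp : G.Reachable s p := (hsz.trans hze).trans hpe.symm.reachable
      have h2 := h.min_le_min_of_right hr hs hsp hrsz h1
      have h3 := h.source_unique hs (le_antisymm (h.le p) (by omega)) hsp
      subst h3
      omega
  -- Since `e` is rightmost and adjacent to `z`, the umbrella property puts every neighbor of `e` in
  -- the closed neighborhood of `z`; and `e`, being found earlier among the children of one parent,
  -- has at least the degree of `z`.
  have htwin : Twin G z e := by
    refine twin_of_subset ?_ (h.tie e z hpos hm hlt)
    rintro y (rfl | hy)
    · exact Or.inr hadj
    · have hye : r y < r e := lt_of_le_of_ne (hmax y (hze.trans hy.reachable))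
        fun he => hy.ne (hr.inj he).symm
      rcases lt_trichotomy (r y) (r z) with h1 | h1 | h1
      · exact Or.inr (hr.adj y z e h1 hze' hy.symm).1.symm
      · exact Or.inl (hr.inj h1)
      · exact Or.inr (hr.adj z y e h1 hye hadj).1
  rcases (hmax x hx).eq_or_lt with he | hxe
  · rwa [hr.inj he]
  obtain ⟨hzx', hxe'⟩ := hr.adj z x e hzx hxe hadj
  intro y
  constructor
  · intro hy
    by_cases hyx : y = x
    · exact Or.inl hyx
    by_cases hyz : y = z
    · exact Or.inr (hyz ▸ hzx'.symm)
    have hzy := hy.adj hyz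
    rcases lt_or_gt_of_ne (fun he => hyx (hr.inj he)) with h1 | h1
    · have hye := htwin.adj_right hzy (by rintro rfl; omega)
      exact Or.inr (hr.adj y x e h1 hxe hye.symm).1.symm
    · exact Or.inr (hr.adj z x y hzx h1 hzy).2
  · rintro (rfl | hy)
    · exact Or.inr hzx'
    · rcases lt_trichotomy (r y) (r z) with h1 | h1 | h1
      · exact Or.inr (hr.adj y z x h1 hzx hy.symm).1.symm
      · exact Or.inl (hr.inj h1)
      · rcases (hmax y (hx.trans hy.reachable)).eq_or_lt with he | hye
        · rw [hr.inj he]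
          exact Or.inr hadj
        · exact Or.inr (hr.adj z y e h1 hye hadj).1

/-- If the source lies to the left of `z`, then `z` is at the right end, and the order is reversed.
-/
theorem exists_isEnd [Finite V] (h : IsBfsOrder G (· ≥ ·) pos m) {r : V → ℤ}
    (hr : IsUmbrella G r) {z : V} (hz : ∀ x, G.Reachable z x → pos x ≤ pos z) :
    ∃ r' : V → ℤ, IsUmbrella G r' ∧ IsEnd G r' z := by
  obtain ⟨s, hs, hsz⟩ := h.exists_source z
  rcases le_total (r s) (r z) with hle | hle
  · refine ⟨_, hr.neg, fun x hx => ?_⟩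
    rcases lt_or_ge (r z) (r x) with h1 | h1
    · exact Or.inr (h.twin_of_last hr hs hsz hle hz hx h1)
    · exact Or.inl (neg_le_neg h1)
  · refine ⟨r, hr, fun x hx => ?_⟩
    rcases lt_or_ge (r x) (r z) with h1 | h1
    · exact Or.inr (h.twin_of_last hr.neg hs hsz (neg_le_neg hle) hz hx (neg_lt_neg h1))
    · exact Or.inl h1

/-- A breadth-first search that starts at an end and prefers small degrees finds the umbrella
order of a component, up to twins. -/
theorem lt_or_twin [Finite V] (h : IsBfsOrder G (· ≤ ·) pos m) {r : V → ℤ}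
    (hr : IsUmbrella G r) {s : V} (hs : m s = pos s) (hend : IsEnd G r s) {a b : V}
    (ha : G.Reachable s a) (hb : G.Reachable s b) (hab : pos a < pos b) :
    r a < r b ∨ Twin G a b := by
  induction hk : pos a using Nat.strong_induction_on generalizing a b with
  | _ k ih =>
    have hne : b ≠ a := fun e => by rw [e] at hab; exact lt_irrefl _ hab
    rcases lt_or_gt_of_ne (fun e => hne (hr.inj e)) with hba | hba
    swap
    · exact Or.inl hba
    right
    rcases (h.le a).eq_or_lt with e | hlt
    · have := h.source_unique hs e ha
      subst this
      exact (hend b hb).resolve_left (by omega)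
    obtain ⟨p, hp, hpa⟩ := h.parent a hlt
    have hsp : G.Reachable s p := ha.trans hpa.symm.reachable
    have hm := h.mono a b hab
    have hpb : p ≠ b := by rintro rfl; omega
    -- Here `b` is to the left of `a` but found later. The induction hypothesis compares `b` with
    -- the parent `p` of `a`. In either case `a` and `b` turn out to be children of `p`, so the
    -- degree of `a` is at most that of `b`, and only the inclusion of closed neighborhoods is left.
    rcases ih (pos p) (by omega) hsp hb (by omega) rfl with h1 | h1
    · obtain ⟨hpb, hba'⟩ := hr.adj p b a h1 hba hpa
      have hm' : m a = m b := le_antisymm hm (hp ▸ h.first p b hpb)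
      refine twin_of_subset ?_ (h.tie a b hab hm' hlt)
      rintro x (rfl | hx)
      · exact Or.inr hba'.symm
      rcases lt_trichotomy (r x) (r b) with h2 | h2 | h2
      · rcases lt_trichotomy (r x) (r p) with h3 | h3 | h3
        -- A neighbor `x` of `b` to the left of `p` is not found before `p`, so the induction
        -- hypothesis leaves only that `x` and `p` are twins; then `x` is adjacent to `a`.
        · have h4 := h.first x b hx.symm
          rcases ih (pos p) (by omega) hsp (hb.trans hx.reachable)
            (lt_of_le_of_ne (by omega) fun e => by rw [h.inj e] at h3; omega) rfl with h5 | h5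
          · omega
          · exact Or.inr (h5.adj_right hpa (by rintro rfl; omega)).symm
        · rw [hr.inj h3]
          exact Or.inr hpa.symm
        · exact Or.inr (hr.adj p x a h3 (h2.trans hba) hpa).2.symm
      · exact absurd (hr.inj h2).symm hx.ne
      · rcases lt_trichotomy (r x) (r a) with h3 | h3 | h3
        · exact Or.inr (hr.adj b x a h2 h3 hba').2.symm
        · exact Or.inl (hr.inj h3)
        · exact Or.inr (hr.adj b a x hba h3 hx).2
    · have hpb' := h1.adj hpb
      have hm' : m a = m b := le_antisymm hm (hp ▸ h.first p b hpb')
      refine twin_of_subset ?_ (h.tie a b hab hm' hlt)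
      -- If `p` had a parent, that vertex would be adjacent to the twin `b` of `p` as well, and `b`
      -- would have been found from it, before `p` was handled.
      have hps : s = p := by
        refine h.source_unique hs (le_antisymm (h.le p) (not_lt.1 fun h2 => ?_)) hsp
        obtain ⟨q, hq, hqp⟩ := h.parent p h2
        have := h.first q b (h1.adj_right hqp.symm (by rintro rfl; omega)).symm
        omega
      subst hps
      intro x hx
      have hsx := (h1 x).2 hx
      by_cases hxa : x = a
      · exact Or.inl hxa
      rcases hsx with rfl | hsx
      · exact Or.inr hpa.symm
      -- Both `x` and `a` are neighbors of the end `s`. If both are to its right, the umbrella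
      -- property makes them adjacent; otherwise one of them is a twin of `s`.
      rcases hend x hsx.reachable with h2 | h2
      · rcases hend a ha with h3 | h3
        · have h2' : r s < r x := lt_of_le_of_ne h2 fun e => hsx.ne (hr.inj e)
          have h3' : r s < r a := lt_of_le_of_ne h3 fun e => hpa.ne (hr.inj e)
          rcases lt_or_gt_of_ne (fun e => hxa (hr.inj e)) with h4 | h4
          · exact Or.inr (hr.adj s x a h2' h4 hpa).2.symm
          · exact Or.inr (hr.adj s a x h3' h4 hsx).2
        · exact Or.inr (h3.adj_right hsx hxa)
      · exact Or.inr (h2.adj_right hpa (Ne.symm hxa)).symm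

/-- Each source may come with its own umbrella order, since components are consecutive and three
vertices with the outer two adjacent lie in one component. A pair out of order consists of twins,
for which both adjacencies are immediate. -/
theorem isUmbrella [Finite V] (h : IsBfsOrder G (· ≤ ·) pos m)
    (hend : ∀ s, m s = pos s → ∃ r : V → ℤ, IsUmbrella G r ∧ IsEnd G r s) :
    IsUmbrella G fun v => (pos v : ℤ) where
  inj := fun a b hab => h.inj (by simpa using hab)
  adj := by
    intro a b c hab hbc hac
    have hab : pos a < pos b := by exact_mod_cast hab
    have hbc : pos b < pos c := by exact_mod_cast hbc
    obtain ⟨s, hs, hsa⟩ := h.exists_source a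
    obtain ⟨r, hr, he⟩ := hend s hs
    have hsc := hsa.trans hac.reachable
    have hsb := hsa.trans (h.reachable_of_between hab hbc hac.reachable)
    have hab' : a ≠ b := by rintro rfl; omega
    have hbc' : b ≠ c := by rintro rfl; omega
    rcases h.lt_or_twin hr hs he hsa hsb hab with h1 | h1
    · rcases h.lt_or_twin hr hs he hsb hsc hbc with h2 | h2
      · exact hr.adj a b c h1 h2 hac
      · exact ⟨(h2.symm.adj_right hac.symm hab').symm, h2.adj hbc'⟩
    · exact ⟨h1.adj hab', h1.adj_right hac hbc'.symm⟩

/-- Two sweeps, the second of which takes its sources from the end of the first, find an umbrella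
order. -/
theorem isUmbrella_of_two_sweeps [Finite V] {pos₁ m₁ : V → ℕ}
    (h : IsBfsOrder G (· ≤ ·) pos m) (h₁ : IsBfsOrder G (· ≥ ·) pos₁ m₁)
    (hsrc : ∀ s, m s = pos s → ∀ x, pos₁ s < pos₁ x → pos x < pos s) {r : V → ℤ}
    (hr : IsUmbrella G r) : IsUmbrella G fun v => (pos v : ℤ) := by
  refine h.isUmbrella fun s hs => h₁.exists_isEnd hr fun x hx => ?_
  by_contra! hlt
  exact absurd (hsrc s hs x hlt) (not_lt.2 (h.le_pos_of_reachable hs le_rfl hx))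

end IsBfsOrder

end Bfs

/-! ### Reasoning about programs -/

/-- Started in memory `s` with `k` steps to spend, the program `p` halts, and `Q` holds of the
final memory and the number of steps left. -/
def Runs (p : Prog) (s : Mem) (k : ℕ) (Q : Mem → ℕ → Prop) : Prop :=
  ∃ t s', Exec p s t s' ∧ t ≤ k ∧ Q s' (k - t)

theorem Runs.mono {p : Prog} {s : Mem} {k : ℕ} {Q Q' : Mem → ℕ → Prop} (h : Runs p s k Q)
    (hQ : ∀ s k, Q s k → Q' s k) : Runs p s k Q' := by
  obtain ⟨t, s', he, ht, hq⟩ := h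
  exact ⟨t, s', he, ht, hQ _ _ hq⟩

theorem Runs.seq {p q : Prog} {s : Mem} {k : ℕ} {Q : Mem → ℕ → Prop}
    (h : Runs p s k fun s' k' => Runs q s' k' Q) : Runs (.seq p q) s k Q := by
  obtain ⟨t, s', he, ht, t', s'', he', ht', hq⟩ := h
  exact ⟨t + t', s'', .seq he he', by omega, by rwa [Nat.sub_sub] at hq⟩

theorem Runs.cond {b : Test} {p q : Prog} {s : Mem} {k : ℕ} {Q : Mem → ℕ → Prop} (hk : 1 ≤ k)
    (hp : b.Holds s → Runs p s (k - 1) Q) (hq : ¬ b.Holds s → Runs q s (k - 1) Q) :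
    Runs (.cond b p q) s k Q := by
  by_cases hb : b.Holds s
  · obtain ⟨t, s', he, ht, h⟩ := hp hb
    exact ⟨t + 1, s', .cond_true hb he, by omega,
      by rwa [show k - (t + 1) = k - 1 - t by omega]⟩
  · obtain ⟨t, s', he, ht, h⟩ := hq hb
    exact ⟨t + 1, s', .cond_false hb he, by omega,
      by rwa [show k - (t + 1) = k - 1 - t by omega]⟩

/-- The steps left serve as the termination measure of a loop. -/
theorem Runs.loop {b : Test} {p : Prog} {Q : Mem → ℕ → Prop} (I : Mem → ℕ → Prop)
    (hpos : ∀ s k, I s k → 1 ≤ k) (hstep : ∀ s k, I s k → b.Holds s → Runs p s (k - 1) I)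
    (hdone : ∀ s k, I s k → ¬ b.Holds s → Q s (k - 1)) {s : Mem} {k : ℕ} (h : I s k) :
    Runs (.loop b p) s k Q := by
  induction k using Nat.strong_induction_on generalizing s with
  | _ k ih =>
    have hk := hpos s k h
    by_cases hb : b.Holds s
    · obtain ⟨t, s', he, ht, hI⟩ := hstep s k h hb
      obtain ⟨t', s'', he', ht', hq⟩ := ih (k - 1 - t) (by omega) hI
      exact ⟨t + t' + 1, s'', .loop_step hb he he', by omega,
        by rwa [show k - (t + t' + 1) = k - 1 - t - t' by omega]⟩
    · exact ⟨1, s, .loop_done hb, hk, hdone s k h hb⟩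

/-- Straight-line code. -/
def Prog.line : List Instr → Prog
  | [] => .instr (.copy 0 0)
  | i :: l => .seq (.instr i) (line l)

/-- The extra step is the copy of variable 0 to itself that ends every line, as there is no empty
program. -/
theorem Runs.line {l : List Instr} {s : Mem} {k : ℕ} {Q : Mem → ℕ → Prop}
    (hk : l.length + 1 ≤ k)
    (h : Q (l.foldl (fun s i => i.apply s) s) (k - (l.length + 1))) :
    Runs (.line l) s k Q := by
  induction l generalizing s k with
  | nil =>
    refine ⟨1, s, ?_, hk, h⟩
    have he := Exec.instr (.copy 0 0) s
    rwa [show (Instr.copy 0 0).apply s = s by simp [Instr.apply]] at he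
  | cons i l ih =>
    refine Runs.seq ⟨1, _, .instr i s, by omega, ?_⟩
    rw [List.length_cons] at hk h
    refine ih (by omega) ?_
    rwa [show k - 1 - (l.length + 1) = k - (l.length + 1 + 1) by omega]

/-- Sequential composition. -/
infixr:60 " ;; " => Prog.seq

/-! ### Lists in arrays -/

section Seg

variable {n : ℕ}

/-- The array `f` holds the list `l` from cell `b` on. -/
def Seg (f : ℕ → ℕ) : ℕ → List (Fin n) → Prop
  | _, [] => True
  | b, w :: l => f b = w ∧ Seg f (b + 1) l

theorem seg_nil {f : ℕ → ℕ} {b : ℕ} : Seg f b ([] : List (Fin n)) := trivial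

theorem seg_cons {f : ℕ → ℕ} {b : ℕ} {w : Fin n} {l : List (Fin n)} :
    Seg f b (w :: l) ↔ f b = w ∧ Seg f (b + 1) l := Iff.rfl

theorem seg_append {f : ℕ → ℕ} {b : ℕ} {l l' : List (Fin n)} :
    Seg f b (l ++ l') ↔ Seg f b l ∧ Seg f (b + l.length) l' := by
  induction l generalizing b with
  | nil => simp [Seg]
  | cons w l ih =>
    rw [List.cons_append, seg_cons, seg_cons, ih, and_assoc, List.length_cons,
      show b + 1 + l.length = b + (l.length + 1) by omega]

theorem seg_iff {f : ℕ → ℕ} {b : ℕ} {l : List (Fin n)} :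
    Seg f b l ↔ ∀ i (h : i < l.length), f (b + i) = l[i] := by
  induction l generalizing b with
  | nil => simp [Seg]
  | cons w l ih =>
    rw [seg_cons, ih]
    constructor
    · rintro ⟨h0, h⟩ (_ | i) hi
      · simpa using h0
      · have := h i (by simpa using hi)
        rwa [show b + 1 + i = b + (i + 1) by omega] at this
    · intro h
      refine ⟨h 0 (by simp), fun i hi => ?_⟩
      have := h (i + 1) (by simpa using hi)
      rwa [show b + (i + 1) = b + 1 + i by omega] at this

theorem Seg.congr {f g : ℕ → ℕ} {b : ℕ} {l : List (Fin n)} (h : Seg f b l)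
    (hg : ∀ j, b ≤ j → j < b + l.length → g j = f j) : Seg g b l := by
  rw [seg_iff] at h ⊢
  intro i hi
  rw [hg _ (by omega) (by omega), h]

theorem Seg.update {f : ℕ → ℕ} {b : ℕ} {l : List (Fin n)} (h : Seg f b l) {j x : ℕ}
    (hj : j < b ∨ b + l.length ≤ j) : Seg (Function.update f j x) b l :=
  h.congr fun i h1 h2 => Function.update_of_ne (by omega) _ _

theorem Seg.concat {f : ℕ → ℕ} {b : ℕ} {l : List (Fin n)} (h : Seg f b l) {j x : ℕ} {w : Fin n}
    (hj : j = b + l.length) (hx : x = w) : Seg (Function.update f j x) b (l ++ [w]) := by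
  subst hj
  rw [seg_append]
  exact ⟨h.update (Or.inr le_rfl), by simp [Seg, hx]⟩

theorem Seg.update_cons {f : ℕ → ℕ} {b : ℕ} {l : List (Fin n)} (h : Seg f (b + 1) l) {x : ℕ}
    {w : Fin n} (hx : x = w) : Seg (Function.update f b x) b (w :: l) :=
  ⟨by simp [hx], h.update (Or.inl (by omega))⟩

end Seg

/-! ### The input -/

section Input

variable {n : ℕ} {G : SimpleGraph (Fin n)} (A : AdjLists G)

theorem AdjLists.seg_flatMap {f : ℕ → ℕ} (l : List (Fin n)) {b : ℕ}
    (h : Seg f b (l.flatMap A.nbrs)) {i : ℕ} (hi : i < l.length) :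
    Seg f (b + ((l.take i).map fun v => (A.nbrs v).length).sum) (A.nbrs l[i]) := by
  induction l generalizing b i with
  | nil => simp at hi
  | cons w l ih =>
    rw [List.flatMap_cons, seg_append] at h
    rcases i with _ | i
    · simpa using h.1
    · have := ih h.2 (i := i) (by simpa using hi)
      simpa [add_assoc] using this

theorem AdjLists.offset_succ (v : Fin n) :
    A.offset (v + 1) = A.offset v + (A.nbrs v).length := by
  have h : (v : ℕ) < (List.finRange n).length := by simp
  rw [AdjLists.offset, AdjLists.offset, List.take_add_one, List.getElem?_eq_getElem h]
  simp

theorem AdjLists.seg_input (k : ℕ) (v : Fin n) :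
    Seg ((A.input k).arr 1) (A.offset v) (A.nbrs v) := by
  have h : Seg ((A.input k).arr 1) 0 A.flat := by
    rw [seg_iff]
    intro i hi
    have hi' : i < (A.flat.map Fin.val).length := by simpa using hi
    simp [AdjLists.input, List.getD_eq_getElem?_getD, List.getElem?_eq_getElem hi]
  have h2 := A.seg_flatMap (List.finRange n) h (i := v) (by simp)
  simpa [AdjLists.offset] using h2

/-- The number of neighbors of `v`. -/
def AdjLists.deg (v : Fin n) : ℕ := (A.nbrs v).length

theorem AdjLists.deg_eq (v : Fin n) : A.deg v = (G.neighborSet v).ncard := by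
  have : G.neighborSet v = ((A.nbrs v).toFinset : Set (Fin n)) := by
    ext w; simp [A.mem_nbrs]
  rw [this, Set.ncard_coe_finset, List.toFinset_card_of_nodup (A.nodup v), AdjLists.deg]

/-- The cost of handling the vertices of `l` and their adjacency lists. -/
def AdjLists.weight (l : List (Fin n)) : ℕ := (l.map fun v => A.deg v + 1).sum

@[simp] theorem AdjLists.weight_nil : A.weight [] = 0 := rfl

@[simp] theorem AdjLists.weight_cons (v : Fin n) (l : List (Fin n)) :
    A.weight (v :: l) = A.deg v + 1 + A.weight l := by simp [AdjLists.weight]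

@[simp] theorem AdjLists.weight_append (l l' : List (Fin n)) :
    A.weight (l ++ l') = A.weight l + A.weight l' := by simp [AdjLists.weight]

theorem AdjLists.weight_perm {l l' : List (Fin n)} (h : l.Perm l') :
    A.weight l = A.weight l' := (h.map _).sum_eq

/-- The degrees sum to twice the number of edges. This bound makes every potential below linear. -/
theorem AdjLists.weight_le {l : List (Fin n)} (h : l.Nodup) :
    A.weight l ≤ 2 * G.edgeSet.ncard + n := by
  classical
  have h1 : A.weight l = ∑ v ∈ l.toFinset, (A.deg v + 1) :=
    (List.sum_toFinset _ h).symm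
  have h2 : ∑ v ∈ l.toFinset, (A.deg v + 1) ≤ ∑ v, (A.deg v + 1) :=
    Finset.sum_le_sum_of_subset (Finset.subset_univ _)
  have h3 : ∑ v, A.deg v = 2 * G.edgeSet.ncard := by
    rw [← SimpleGraph.coe_edgeFinset, Set.ncard_coe_finset, ← G.sum_degrees_eq_twice_card_edges]
    refine Finset.sum_congr rfl fun v _ => ?_
    rw [A.deg_eq, Set.ncard_eq_toFinset_card']
    rfl
  rw [h1]
  refine h2.trans (le_of_eq ?_)
  rw [Finset.sum_add_distrib, h3]
  simp

/-- The memory still holds the input, and the constants `0` and `1`. -/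
structure HoldsInput (k : ℕ) (s : Mem) : Prop where
  size : s.var 0 = n
  colors : s.var 1 = k
  zero : s.var 3 = 0
  one : s.var 4 = 1
  start : ∀ v : Fin n, Seg (s.arr 1) (s.arr 0 v) (A.nbrs v)
  finish : ∀ v : Fin n, s.arr 0 (v + 1) = s.arr 0 v + A.deg v

variable {A}

theorem HoldsInput.congr {k : ℕ} {s s' : Mem} (h : HoldsInput A k s) (h0 : s'.var 0 = s.var 0)
    (h1 : s'.var 1 = s.var 1) (h3 : s'.var 3 = s.var 3) (h4 : s'.var 4 = s.var 4)
    (ha : s'.arr 0 = s.arr 0) (hb : s'.arr 1 = s.arr 1) : HoldsInput A k s' where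
  size := h0.trans h.size
  colors := h1.trans h.colors
  zero := h3.trans h.zero
  one := h4.trans h.one
  start := by rw [ha, hb]; exact h.start
  finish := by rw [ha]; exact h.finish

variable (A)

theorem holdsInput_init (k : ℕ) : HoldsInput A k ((Instr.lit 4 1).apply (A.input k)) := by
  have h0 : ∀ i ≤ n, (A.input k).arr 0 i = A.offset i := fun i hi => by
    simp [AdjLists.input, hi]
  refine ⟨by simp [Instr.apply, AdjLists.input], by simp [Instr.apply, AdjLists.input],
    by simp [Instr.apply, AdjLists.input], by simp [Instr.apply], fun v => ?_, fun v => ?_⟩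
  · simp only [Instr.apply]
    rw [h0 v v.2.le]
    exact A.seg_input k v
  · simp only [Instr.apply]
    rw [h0 v v.2.le, h0 (v + 1) v.2, A.offset_succ, AdjLists.deg]

end Input

section

/-! ### The program

Variables: 0 is the number of vertices, 1 the number of colors, 2 the answer, 3 and 4 hold the
constants 0 and 1, 5 counts the sources (or positions), 6 and 7 are head and tail of the queue,
8 is the current vertex, 9 and 10 delimit its adjacency list, 11 and 12 are auxiliary, 13 is the
number of vertices in the working list, 14 the place in the queue to write to, 15 and 16 are
indices into the working list, 17 is the current degree.
Arrays: 0 and 1 are the input, 2 is the queue, 3 the coloring, 4 the list of sources, 5 marks the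
vertices in the queue, 6 is the working list, 7 holds the degrees. -/

/-- Let the variables 9 and 10 delimit the adjacency list of the vertex in variable 8. -/
def openList : List Instr := [.load 9 0 8, .copy 12 8, .inc 12, .load 10 0 12]

/-- Mark the unmarked neighbors of the vertex in variable 8 and collect them in the working
list. -/
def gather : Prog :=
  .line (openList ++ [.lit 13 0]) ;;
  .loop (.lt 9 10)
    (.line [.load 11 1 9, .inc 9, .load 12 5 11] ;;
     .cond (.eq 12 3) (.line [.store 5 11 4, .store 6 13 11, .inc 13, .inc 7]) (.line []))

/-- Append the vertex in variable 11 to the list that is being written to the queue upwards, or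
prepend it to the one that is being written downwards. -/
def emit (up : Bool) : List Instr :=
  if up then [.store 2 14 11, .inc 14] else [.dec 14, .store 2 14 11]

/-- Move the working list to the queue, sorted by degree. In round `d` the vertices of degree `d`
are moved, and the others are kept. -/
def peel (up : Bool) : Prog :=
  .line [.lit 15 0, .lit 16 0, .lit 17 0] ;;
  .loop (.lt 3 13)
    (.cond (.lt 15 13)
      (.line [.load 11 6 15, .inc 15, .load 12 7 11] ;;
       .cond (.eq 12 17) (.line (emit up)) (.line [.store 6 16 11, .inc 16]))
      (.line [.copy 13 16, .lit 15 0, .lit 16 0, .inc 17]))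

/-! ### Collecting the new neighbors and sorting them by degree -/

variable {n : ℕ} {G : SimpleGraph (Fin n)} {A : AdjLists G}

theorem runs_gather {k c : ℕ} {s : Mem} (hI : HoldsInput A k s) {v : Fin n} (hv : s.var 8 = v)
    {q : List (Fin n)} (htail : s.var 7 = q.length)
    (hmark : ∀ w : Fin n, s.arr 5 w = if w ∈ q then 1 else 0)
    (hc : 11 * (A.deg v + 1) ≤ c) :
    Runs gather s c fun s' c' => HoldsInput A k s' ∧
      (s'.var 5 = s.var 5 ∧ s'.var 6 = s.var 6 ∧ s'.var 14 = s.var 14 ∧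
        s'.arr 2 = s.arr 2 ∧ s'.arr 4 = s.arr 4 ∧ s'.arr 7 = s.arr 7) ∧
      c ≤ c' + 11 * (A.deg v + 1) ∧
      ∃ l : List (Fin n), l = (A.nbrs v).filter (· ∉ q) ∧ s'.var 13 = l.length ∧
        s'.var 7 = q.length + l.length ∧ Seg (s'.arr 6) 0 l ∧
        ∀ w : Fin n, s'.arr 5 w = if w ∈ q ∨ w ∈ l then 1 else 0 := by
  refine Runs.seq (Runs.line (by simp [openList]; omega) ?_)
  -- `l` is the part of the adjacency list already read and `r` the rest; reading one entry takes at
  -- most 11 steps, tests included.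
  refine Runs.loop (fun s' c' => HoldsInput A k s' ∧
      (s'.var 5 = s.var 5 ∧ s'.var 6 = s.var 6 ∧ s'.var 14 = s.var 14 ∧
        s'.arr 2 = s.arr 2 ∧ s'.arr 4 = s.arr 4 ∧ s'.arr 7 = s.arr 7) ∧
      ∃ l r : List (Fin n), A.nbrs v = l ++ r ∧
        Seg (s'.arr 1) (s'.var 9) r ∧ s'.var 10 = s'.var 9 + r.length ∧
        11 * r.length + 1 ≤ c' ∧ c + 11 * r.length + 1 ≤ c' + 11 * (A.deg v + 1) ∧
        s'.var 13 = (l.filter (· ∉ q)).length ∧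
        s'.var 7 = q.length + (l.filter (· ∉ q)).length ∧ Seg (s'.arr 6) 0 (l.filter (· ∉ q)) ∧
        ∀ w : Fin n, s'.arr 5 w = if w ∈ q ∨ w ∈ l.filter (· ∉ q) then 1 else 0) ?_ ?_ ?_ ?_
  · rintro s' c' ⟨-, -, l, r, -, -, -, hc', -⟩
    omega
  · rintro s' c' ⟨hI', ⟨f1, f2, f3, f4, f5, f6⟩, l, r, hlr, hr, hlast, hc1, hc2, h13, h7, h6, h5⟩ hb
    simp only [Test.Holds, hlast] at hb
    obtain _ | ⟨w, r⟩ := r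
    · simp at hb
    obtain ⟨hw, hr⟩ := hr
    -- Adjacency lists have no repetitions, so a mark on `w` can only come from `q`.
    have hwl : w ∉ l := by
      have := A.nodup v
      rw [hlr, List.nodup_append] at this
      exact fun hw => this.2.2 w hw w (by simp) rfl
    simp only [List.length_cons] at hc1 hc2 hlast
    have hlr' : A.nbrs v = (l ++ [w]) ++ r := by simp [hlr]
    refine Runs.seq (Runs.line (by simp; omega) ?_)
    by_cases hwq : w ∈ q
    · have h0 : s'.arr 5 w = 1 := by simp [h5, hwq]
      refine Runs.cond (by simp; omega) ?_ fun _ => Runs.line (by simp; omega) ?_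
      · intro h
        simp [Test.Holds, Instr.apply, hw, h0, hI'.zero] at h
      have hfil : (l ++ [w]).filter (· ∉ q) = l.filter (· ∉ q) := by simp [hwq]
      refine ⟨hI'.congr ?_ ?_ ?_ ?_ ?_ ?_, ⟨?_, ?_, ?_, ?_, ?_, ?_⟩, l ++ [w], r, hlr', ?_, ?_, ?_,
        ?_, ?_, ?_, ?_, ?_⟩
      all_goals try rw [hfil]
      rotate_right 2
      · exact h6
      · exact h5
      all_goals simp [Instr.apply, *]
      all_goals omega
    · have h0 : s'.arr 5 w = 0 := by simp [h5, hwq, hwl]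
      refine Runs.cond (by simp; omega) (fun _ => Runs.line (by simp; omega) ?_) ?_
      swap
      · intro h
        simp [Test.Holds, Instr.apply, hw, h0, hI'.zero] at h
      have hfil : (l ++ [w]).filter (· ∉ q) = l.filter (· ∉ q) ++ [w] := by simp [hwq]
      refine ⟨hI'.congr ?_ ?_ ?_ ?_ ?_ ?_, ⟨?_, ?_, ?_, ?_, ?_, ?_⟩, l ++ [w], r, hlr', ?_, ?_, ?_,
        ?_, ?_, ?_, ?_, ?_⟩
      all_goals try rw [hfil]
      rotate_right 2
      · exact h6.concat (by simp [Instr.apply, h13]) (by simp [Instr.apply, hw])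
      · intro x
        by_cases hx : x = w
        · simp [Instr.apply, hw, hx, hI'.one]
        · have hx' : (x : ℕ) ≠ w := fun e => hx (Fin.ext e)
          simp [Instr.apply, hw, hx, hx', h5]
      all_goals simp [Instr.apply, *]
      all_goals omega
  · rintro s' c' ⟨hI', hf, l, r, hlr, hr, hlast, hc1, hc2, h13, h7, h6, h5⟩ hb
    simp only [Test.Holds, hlast] at hb
    have : r = [] := List.length_eq_zero_iff.1 (by omega)
    subst this
    rw [List.append_nil] at hlr
    rw [← hlr] at h13 h7 h6 h5
    exact ⟨hI', hf, by simp at hc1 hc2; omega, _, rfl, h13, h7, h6, h5⟩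
  · have hs := hI.finish v
    have hlen : A.deg v = (A.nbrs v).length := rfl
    refine ⟨hI.congr ?_ ?_ ?_ ?_ ?_ ?_, ⟨?_, ?_, ?_, ?_, ?_, ?_⟩, [], A.nbrs v, rfl, ?_, ?_, ?_,
        ?_, ?_, ?_, ?_, ?_⟩
    all_goals simp [openList, Instr.apply, hv, hI.start, hs, ← hlen, htail, seg_nil, hmark]
    all_goals omega

/-- The list `o` has been written to the array `f`, in the `total` cells from `base` on, and `p` is
the place to write to: from the bottom upwards, or from the top downwards. -/
def Emitted (up : Bool) (f : ℕ → ℕ) (base total p : ℕ) (o : List (Fin n)) : Prop :=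
  if up then p = base + o.length ∧ Seg f base o
  else p + o.length = base + total ∧ Seg f p o.reverse

theorem length_emit (up : Bool) : (emit up).length = 2 := by cases up <;> rfl

theorem Emitted.emit {up : Bool} {s : Mem} {base total : ℕ} {o : List (Fin n)}
    (h : Emitted up (s.arr 2) base total (s.var 14) o) (ho : o.length < total) {w : Fin n}
    (hw : s.var 11 = w) {s' : Mem} (hs' : s' = (emit up).foldl (fun s i => i.apply s) s) :
    Emitted up (s'.arr 2) base total (s'.var 14) (o ++ [w]) ∧
      (∀ x, x ≠ 14 → s'.var x = s.var x) ∧ (∀ a, a ≠ 2 → s'.arr a = s.arr a) ∧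
      ∀ j < base, s'.arr 2 j = s.arr 2 j := by
  subst hs'
  cases up
  · obtain ⟨h1, h2⟩ := h
    refine ⟨⟨?_, ?_⟩, ?_, ?_, ?_⟩
    · simp [EquitableTree.emit, Instr.apply]
      omega
    · have h3 : s.var 14 = s.var 14 - 1 + 1 := by omega
      rw [h3] at h2
      simpa [EquitableTree.emit, Instr.apply] using h2.update_cons hw
    · intro x hx
      simp [EquitableTree.emit, Instr.apply, hx]
    · intro a ha
      simp [EquitableTree.emit, Instr.apply, ha]
    · intro j hj
      have : j ≠ s.var 14 - 1 := by omega
      simp [EquitableTree.emit, Instr.apply, this]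
  · obtain ⟨h1, h2⟩ := h
    refine ⟨⟨?_, ?_⟩, ?_, ?_, ?_⟩
    · simp [EquitableTree.emit, Instr.apply]
      omega
    · simpa [EquitableTree.emit, Instr.apply] using h2.concat h1 hw
    · intro x hx
      simp [EquitableTree.emit, Instr.apply, hx]
    · intro a ha
      simp [EquitableTree.emit, Instr.apply, ha]
    · intro j hj
      have : j ≠ s.var 14 := by omega
      simp [EquitableTree.emit, Instr.apply, this]

/-- The number of rounds, from round `d` on, that the vertices of `l` take part in, in total. -/
def AdjLists.rounds (A : AdjLists G) (d : ℕ) (l : List (Fin n)) : ℕ :=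
  (l.map fun v => A.deg v + 1 - d).sum

@[simp] theorem AdjLists.rounds_nil (d : ℕ) : A.rounds d [] = 0 := rfl

@[simp] theorem AdjLists.rounds_cons (d : ℕ) (v : Fin n) (l : List (Fin n)) :
    A.rounds d (v :: l) = A.deg v + 1 - d + A.rounds d l := by simp [AdjLists.rounds]

@[simp] theorem AdjLists.rounds_append (d : ℕ) (l l' : List (Fin n)) :
    A.rounds d (l ++ l') = A.rounds d l + A.rounds d l' := by simp [AdjLists.rounds]

theorem AdjLists.rounds_zero (l : List (Fin n)) : A.rounds 0 l = A.weight l := rfl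

/-- The order that the vertices seen from a common neighbor are put in. -/
def DegreeRel (up : Bool) (a b : ℕ) : Prop := if up then a ≤ b else b ≤ a

/-- In round `d` all vertices of the working list have degree at least `d`, so a vertex takes part
in `deg + 1` rounds, and all rounds together cost a multiple of `weight`. Ascending degrees written
downwards give the descending order. -/
theorem runs_peel {up : Bool} {k c : ℕ} {s : Mem} (hI : HoldsInput A k s)
    (hdeg : ∀ v : Fin n, s.arr 7 v = A.deg v) {l : List (Fin n)} (hlen : s.var 13 = l.length)
    (hl : Seg (s.arr 6) 0 l) {base : ℕ}
    (hbase : s.var 14 = if up then base else base + l.length)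
    (hc : 17 * A.weight l + 5 ≤ c) :
    Runs (peel up) s c fun s' c' => HoldsInput A k s' ∧
      (s'.var 5 = s.var 5 ∧ s'.var 6 = s.var 6 ∧ s'.var 7 = s.var 7 ∧
        s'.arr 4 = s.arr 4 ∧ s'.arr 5 = s.arr 5 ∧ s'.arr 7 = s.arr 7) ∧
      c ≤ c' + (17 * A.weight l + 5) ∧
      (∀ j < base, s'.arr 2 j = s.arr 2 j) ∧
      ∃ o : List (Fin n), o.Perm l ∧ o.Pairwise (fun a b => DegreeRel up (A.deg a) (A.deg b)) ∧
        Seg (s'.arr 2) base o := by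
  refine Runs.seq (Runs.line (by simp; omega) ?_)
  -- `o` has been moved, `kept` is compacted at the bottom of the working list for the next round,
  -- `rest` is still to be looked at in this one. Of the 17 units per participation, 10 pay for
  -- looking at the vertex; the other 7 are saved in the term `7 * s'.var 15` and pay for the change
  -- of rounds, which happens only after at least one vertex was looked at.
  refine Runs.loop (fun s' c' => HoldsInput A k s' ∧
      (s'.var 5 = s.var 5 ∧ s'.var 6 = s.var 6 ∧ s'.var 7 = s.var 7 ∧
        s'.arr 4 = s.arr 4 ∧ s'.arr 5 = s.arr 5 ∧ s'.arr 7 = s.arr 7) ∧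
      (∀ j < base, s'.arr 2 j = s.arr 2 j) ∧
      ∃ o kept rest : List (Fin n), (o ++ (kept ++ rest)).Perm l ∧
        (o.Pairwise (fun a b => A.deg a ≤ A.deg b) ∧ (∀ x ∈ o, A.deg x ≤ s'.var 17) ∧
          (∀ x ∈ kept, s'.var 17 < A.deg x) ∧ ∀ x ∈ rest, s'.var 17 ≤ A.deg x) ∧
        Emitted up (s'.arr 2) base l.length (s'.var 14) o ∧
        (Seg (s'.arr 6) 0 kept ∧ s'.var 16 = kept.length ∧ kept.length ≤ s'.var 15) ∧
        (Seg (s'.arr 6) (s'.var 15) rest ∧ s'.var 13 = s'.var 15 + rest.length) ∧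
        c + (17 * (A.rounds (s'.var 17 + 1) kept + A.rounds (s'.var 17) rest) +
          7 * s'.var 15 + 1) ≤ c' + (17 * A.weight l + 5)) ?_ ?_ ?_ ?_
  · rintro s' c' ⟨-, -, -, o, kept, rest, -, -, -, -, -, h⟩
    omega
  · rintro s' c' ⟨hI', hf, hbelow, o, kept, rest, hperm, ⟨hsort, ho, hkept, hrest⟩, hem,
      ⟨k1, k2, k3⟩, ⟨r1, r2⟩, hcr⟩ hb
    have hf7 := hf.2.2.2.2.2
    have hc' : 2 ≤ c' := by
      obtain _ | ⟨w, rest⟩ := rest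
      · simp only [Test.Holds, r2, hI'.zero, List.length_nil] at hb
        omega
      · have := hrest w (by simp)
        rw [AdjLists.rounds_cons] at hcr
        omega
    refine Runs.cond (by omega) (fun h => ?_) (fun h => ?_)
    · simp only [Test.Holds, r2] at h
      obtain _ | ⟨w, rest⟩ := rest
      · simp at h
      obtain ⟨hw, r1⟩ := r1
      have hdw : s'.var 17 ≤ A.deg w := hrest w (by simp)
      have hpl := hperm.length_eq
      simp only [List.length_append, List.length_cons] at hpl
      simp only [AdjLists.rounds_cons] at hcr
      simp only [List.length_cons] at r2
      refine Runs.seq (Runs.line (by simp; omega) (Runs.cond (by simp; omega)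
        (fun h => Runs.line ?_ ?_) (fun h => Runs.line ?_ ?_)))
      · simp [length_emit]; omega
      · set s1 := List.foldl (fun s i => Instr.apply i s) s'
          [Instr.load 11 6 15, Instr.inc 15, Instr.load 12 7 11] with hs1
        have hv : ∀ x, x ≠ 11 → x ≠ 12 → x ≠ 15 → s1.var x = s'.var x := by
          intro x h1 h2 h3
          simp [hs1, Instr.apply, h1, h2, h3]
        have ha : s1.arr = s'.arr := by simp [hs1, Instr.apply]
        have h11 : s1.var 11 = w := by simp [hs1, Instr.apply, hw]
        have h15 : s1.var 15 = s'.var 15 + 1 := by simp [hs1, Instr.apply]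
        have h12 : s1.var 12 = A.deg w := by simp [hs1, Instr.apply, hw, hf7, hdeg]
        have hdw' : A.deg w = s'.var 17 := by
          simpa only [Test.Holds, h12, hv 17 (by simp) (by simp) (by simp)] using h
        obtain ⟨e1, e2, e3, e4⟩ := Emitted.emit (s := s1) (o := o) (w := w) (base := base)
          (total := l.length) (up := up)
          (by rw [ha, hv 14 (by simp) (by simp) (by simp)]; exact hem) (by omega) h11 rfl
        set s2 := List.foldl (fun s i => Instr.apply i s) s1 (emit up) with hs2
        have hv2 : ∀ x, x ≠ 11 → x ≠ 12 → x ≠ 14 → x ≠ 15 → s2.var x = s'.var x :=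
          fun x h1 h2 h3 h4 => (e2 x h3).trans (hv x h1 h2 h4)
        have ha2 : ∀ a, a ≠ 2 → s2.arr a = s'.arr a := fun a h => (e3 a h).trans (by rw [ha])
        have h152 : s2.var 15 = s'.var 15 + 1 := (e2 15 (by simp)).trans h15
        have h17 : s2.var 17 = s'.var 17 := hv2 17 (by simp) (by simp) (by simp) (by simp)
        have h16 : s2.var 16 = s'.var 16 := hv2 16 (by simp) (by simp) (by simp) (by simp)
        have h13 : s2.var 13 = s'.var 13 := hv2 13 (by simp) (by simp) (by simp) (by simp)
        have h6 : s2.arr 6 = s'.arr 6 := ha2 6 (by simp)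
        refine ⟨hI'.congr ?_ ?_ ?_ ?_ ?_ ?_, ⟨?_, ?_, ?_, ?_, ?_, ?_⟩, ?_, o ++ [w], kept, rest,
          ?_, ⟨?_, ?_, ?_, ?_⟩, e1, ⟨?_, ?_, ?_⟩, ⟨?_, ?_⟩, ?_⟩
        iterate 4 exact hv2 _ (by simp) (by simp) (by simp) (by simp)
        iterate 2 exact ha2 _ (by simp)
        · exact (hv2 5 (by simp) (by simp) (by simp) (by simp)).trans hf.1
        · exact (hv2 6 (by simp) (by simp) (by simp) (by simp)).trans hf.2.1
        · exact (hv2 7 (by simp) (by simp) (by simp) (by simp)).trans hf.2.2.1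
        · exact (ha2 4 (by simp)).trans hf.2.2.2.1
        · exact (ha2 5 (by simp)).trans hf.2.2.2.2.1
        · exact (ha2 7 (by simp)).trans hf.2.2.2.2.2
        · intro j hj
          rw [e4 j hj, ha, hbelow j hj]
        · refine List.Perm.trans ?_ hperm
          rw [List.append_assoc]
          exact List.Perm.append_left o (by
            rw [List.singleton_append]
            exact List.perm_middle.symm)
        · rw [List.pairwise_append]
          refine ⟨hsort, by simp, fun a hoa b hb => ?_⟩
          rw [List.mem_singleton.1 hb, hdw']
          exact ho a hoa
        · intro x hx
          rw [h17]
          rcases List.mem_append.1 hx with hx | hx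
          · exact ho x hx
          · rw [List.mem_singleton.1 hx, hdw']
        · rw [h17]; exact hkept
        · rw [h17]; exact fun x hx => hrest x (by simp [hx])
        · rw [h6]; exact k1
        · rw [h16]; exact k2
        · omega
        · rw [h6, h152]; exact r1
        · omega
        · rw [h152, h17]
          simp [length_emit]
          omega
      · simp; omega
      · have hdw' : s'.var 17 < A.deg w := by
          refine lt_of_le_of_ne hdw fun e => h ?_
          simp [Test.Holds, Instr.apply, hw, hf7, hdeg, e]
        refine ⟨hI'.congr ?_ ?_ ?_ ?_ ?_ ?_, ⟨?_, ?_, ?_, ?_, ?_, ?_⟩, ?_, o, kept ++ [w], rest,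
          ?_, ⟨hsort, ?_, ?_, ?_⟩, ?_, ⟨?_, ?_, ?_⟩, ⟨?_, ?_⟩, ?_⟩
        rotate_right 11
        · simpa using hperm
        · simpa [Instr.apply] using ho
        · intro x hx
          have hx' := List.mem_append.1 hx
          simp only [List.mem_singleton] at hx'
          rcases hx' with hx' | rfl
          · simpa [Instr.apply] using hkept x hx'
          · simpa [Instr.apply] using hdw'
        · intro x hx
          simpa [Instr.apply] using hrest x (by simp [hx])
        · simpa [Instr.apply] using hem
        · exact k1.concat (by simp [Instr.apply, k2]) (by simp [Instr.apply, hw])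
        · simp [Instr.apply, k2]
        · simp [Instr.apply]; omega
        · have : Seg (Function.update (s'.arr 6) (s'.var 16) w) (s'.var 15 + 1) rest :=
            r1.update (Or.inl (by omega))
          simpa [Instr.apply, hw] using this
        · simp [Instr.apply]; omega
        · simp [Instr.apply]; omega
        all_goals simp [Instr.apply, hf]
        exact hbelow
    · simp only [Test.Holds, r2] at h hb
      have hrest0 : rest = [] := List.length_eq_zero_iff.1 (by omega)
      subst hrest0
      simp [hI'.zero] at hb
      simp at hcr
      refine Runs.line (by simp; omega) ?_
      refine ⟨hI'.congr ?_ ?_ ?_ ?_ ?_ ?_, ⟨?_, ?_, ?_, ?_, ?_, ?_⟩, ?_, o, [], kept,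
          ?_, ⟨hsort, ?_, ?_, ?_⟩, ?_, ⟨seg_nil, ?_, ?_⟩, ⟨?_, ?_⟩, ?_⟩
      rotate_right 10
      · simpa using hperm
      · intro x hx
        have := ho x hx
        simp [Instr.apply]
        omega
      · simp
      · intro x hx
        simpa [Instr.apply] using hkept x hx
      · simpa [Instr.apply] using hem
      · simp [Instr.apply]
      · simp
      · simpa [Instr.apply] using k1
      · simp [Instr.apply, k2]
      · simp [Instr.apply]; omega
      all_goals simp [Instr.apply, hf]
      exact hbelow
  · rintro s' c' ⟨hI', hf, hbelow, o, kept, rest, hperm, ⟨hsort, ho, hkept, hrest⟩, hem,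
      ⟨k1, k2, k3⟩, ⟨r1, r2⟩, hcr⟩ hb
    simp only [Test.Holds, r2, hI'.zero] at hb
    have hrest0 : rest = [] := List.length_eq_zero_iff.1 (by omega)
    have hkept0 : kept = [] := List.length_eq_zero_iff.1 (by omega)
    subst hrest0 hkept0
    simp only [List.append_nil] at hperm
    refine ⟨hI', hf, by omega, hbelow, ?_⟩
    have hol := hperm.length_eq
    cases up
    · obtain ⟨h1, h2⟩ := hem
      refine ⟨o.reverse, (List.reverse_perm o).trans hperm, ?_, ?_⟩
      · rw [List.pairwise_reverse]
        exact hsort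
      · rwa [show s'.var 14 = base by omega] at h2
    · exact ⟨o, hperm, hsort, hem.2⟩
  · refine ⟨hI.congr ?_ ?_ ?_ ?_ ?_ ?_, ⟨?_, ?_, ?_, ?_, ?_, ?_⟩, ?_, [], [], l, by simp,
          ⟨by simp, by simp, by simp, ?_⟩, ?_, ⟨seg_nil, ?_, ?_⟩, ⟨?_, ?_⟩, ?_⟩
    rotate_right 7
    · simp [Instr.apply]
    · cases up <;> simpa [Emitted, seg_nil, Instr.apply] using hbase
    · simp [Instr.apply]
    · simp
    · simpa [Instr.apply] using hl
    · simpa [Instr.apply] using hlen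
    · simp [Instr.apply, AdjLists.rounds_zero]
      omega
    all_goals simp [Instr.apply]

end

/-! ### Invariants of an unfinished breadth-first search -/

section PartialBfs

variable {V : Type*} [DecidableEq V] {G : SimpleGraph V}

/-- The queue `q` of a breadth-first search whose first `h` vertices have been handled. Here `m` is
the least position in the closed neighborhood, `src` is the list of sources, and the vertices first
seen from a common neighbor are ordered by `d`, with respect to `R`. -/
structure PartialBfs (G : SimpleGraph V) (d : V → ℕ) (R : ℕ → ℕ → Prop) (src q : List V)
    (m : V → ℕ) (h : ℕ) : Prop where
  nodup : q.Nodup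
  le_length : h ≤ q.length
  closed : ∀ a ∈ q, q.idxOf a < h → ∀ x, G.Adj a x → x ∈ q
  le : ∀ a ∈ q, m a ≤ q.idxOf a
  bound : ∀ a ∈ q, m a < h ∨ m a = h ∧ q.idxOf a = h
  parent : ∀ a ∈ q, m a < q.idxOf a → ∃ p ∈ q, q.idxOf p = m a ∧ G.Adj p a
  first : ∀ a ∈ q, ∀ x, G.Adj x a → m a ≤ q.idxOf x
  mono : ∀ a ∈ q, ∀ b ∈ q, q.idxOf a < q.idxOf b → m a ≤ m b
  tie : ∀ a ∈ q, ∀ b ∈ q, q.idxOf a < q.idxOf b → m a = m b → m a < q.idxOf a → R (d a) (d b)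
  source : ∀ a ∈ q, m a = q.idxOf a → ∀ x, src.idxOf x < src.idxOf a →
    x ∈ q ∧ q.idxOf x < q.idxOf a

namespace PartialBfs

variable {d : V → ℕ} {R : ℕ → ℕ → Prop} {src q : List V} {m : V → ℕ} {h : ℕ}

theorem nil (G : SimpleGraph V) (d : V → ℕ) (R : ℕ → ℕ → Prop) (src : List V) (m : V → ℕ) :
    PartialBfs G d R src [] m 0 := by
  constructor <;> simp

theorem idxOf_append_left {l : List V} {a : V} (ha : a ∈ q) : (q ++ l).idxOf a = q.idxOf a :=
  List.idxOf_append_of_mem ha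

theorem idxOf_append_right {l : List V} {a : V} (ha : a ∉ q) :
    (q ++ l).idxOf a = q.length + l.idxOf a := List.idxOf_append_of_notMem ha

/-- With all of the queue handled, it is closed under adjacency, so `s` has no neighbor in it and
its own position is the least in its closed neighborhood. -/
theorem source_step (H : PartialBfs G d R src q m h) (hh : h = q.length) {s : V} (hs : s ∉ q)
    (hsrc : ∀ x, src.idxOf x < src.idxOf s → x ∈ q) :
    PartialBfs G d R src (q ++ [s]) (fun a => if a ∈ q then m a else h) h := by
  have hsp : (q ++ [s]).idxOf s = q.length := by rw [idxOf_append_right hs]; simp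
  have hmem : ∀ {a}, a ∈ q ++ [s] → a ∈ q ∧ (q ++ [s]).idxOf a = q.idxOf a ∧ q.idxOf a < h ∨
      a = s := by
    intro a ha
    by_cases haq : a ∈ q
    · exact Or.inl ⟨haq, idxOf_append_left haq, hh ▸ List.idxOf_lt_length_iff.2 haq⟩
    · simpa [haq] using ha
  constructor
  · rw [List.nodup_append]
    exact ⟨H.nodup, by simp, fun a ha b hb => by
      rw [List.mem_singleton.1 hb]; rintro rfl; exact hs ha⟩
  · simp; omega
  · intro a ha hlt x hx
    rcases hmem ha with ⟨haq, e, h1⟩ | rfl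
    · exact List.mem_append_left _ (H.closed a haq h1 x hx)
    · omega
  · intro a ha
    rcases hmem ha with ⟨haq, e, h1⟩ | rfl
    · simpa [haq, e] using H.le a haq
    · simp [hs, hsp, hh]
  · intro a ha
    rcases hmem ha with ⟨haq, e, h1⟩ | rfl
    · simpa [haq, e] using H.bound a haq
    · simp [hs, hsp, hh]
  · intro a ha hlt
    rcases hmem ha with ⟨haq, e, h1⟩ | rfl
    · simp only [haq, e, if_true] at hlt ⊢
      obtain ⟨p, hp, hp1, hp2⟩ := H.parent a haq hlt
      exact ⟨p, List.mem_append_left _ hp, (idxOf_append_left hp).trans hp1, hp2⟩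
    · simp [hs, hsp, hh] at hlt
  · intro a ha x hx
    rcases hmem ha with ⟨haq, e, h1⟩ | rfl
    · have hxq := H.closed a haq h1 x hx.symm
      simp only [haq, if_true, idxOf_append_left hxq]
      exact H.first a haq x hx
    · have hxq : x ∉ q := fun hxq =>
        hs (H.closed x hxq (hh ▸ List.idxOf_lt_length_iff.2 hxq) _ hx)
      simp only [hs, if_false, idxOf_append_right hxq]
      omega
  · intro a ha b hb hab
    rcases hmem ha with ⟨haq, e, h1⟩ | rfl <;> rcases hmem hb with ⟨hbq, e', h2⟩ | rfl
    · simp only [haq, hbq, if_true]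
      exact H.mono a haq b hbq (by omega)
    · simp only [haq, hs, if_true, if_false]
      exact (H.le a haq).trans h1.le
    · omega
    · omega
  · intro a ha b hb hab hm hlt
    rcases hmem ha with ⟨haq, e, h1⟩ | rfl <;> rcases hmem hb with ⟨hbq, e', h2⟩ | rfl
    · simp only [haq, hbq, if_true] at hm hlt
      exact H.tie a haq b hbq (by omega) hm (by omega)
    · simp only [haq, hs, if_true, if_false] at hm hlt
      omega
    · omega
    · omega
  · intro a ha hm x hx
    rcases hmem ha with ⟨haq, e, h1⟩ | rfl
    · simp only [haq, if_true, e] at hm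
      obtain ⟨h2, h3⟩ := H.source a haq hm x hx
      exact ⟨List.mem_append_left _ h2, by rw [idxOf_append_left h2, e]; exact h3⟩
    · have hxq := hsrc x hx
      refine ⟨List.mem_append_left _ hxq, ?_⟩
      rw [idxOf_append_left hxq, hsp]
      exact List.idxOf_lt_length_iff.2 hxq

/-- A vertex appended now has no neighbor among the handled ones, since those have all their
neighbors in the queue. Hence `q[h]` is its first neighbor, and `h` is at least every earlier value
of `m`. -/
theorem visit_step (H : PartialBfs G d R src q m h) (hh : h < q.length) {l : List V}
    (hl : l.Nodup) (hlmem : ∀ x, x ∈ l ↔ G.Adj q[h] x ∧ x ∉ q)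
    (hsort : l.Pairwise fun a b => R (d a) (d b)) :
    PartialBfs G d R src (q ++ l) (fun a => if a ∈ q then m a else h) (h + 1) := by
  have hv : q.idxOf q[h] = h := H.nodup.idxOf_getElem h hh
  have hmem : ∀ {a}, a ∈ q ++ l →
      a ∈ q ∧ (q ++ l).idxOf a = q.idxOf a ∧ q.idxOf a < q.length ∨
      a ∈ l ∧ a ∉ q ∧ (q ++ l).idxOf a = q.length + l.idxOf a := by
    intro a ha
    by_cases haq : a ∈ q
    · exact Or.inl ⟨haq, idxOf_append_left haq, List.idxOf_lt_length_iff.2 haq⟩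
    · exact Or.inr ⟨by simpa [haq] using ha, haq, idxOf_append_right haq⟩
  constructor
  · rw [List.nodup_append]
    refine ⟨H.nodup, hl, fun a ha b hb => ?_⟩
    rintro rfl
    exact ((hlmem a).1 hb).2 ha
  · simp; omega
  · intro a ha hlt x hx
    rcases hmem ha with ⟨haq, e, h1⟩ | ⟨hal, haq, e⟩
    · rcases (Nat.lt_succ_iff.1 (e ▸ hlt)).eq_or_lt with e' | h2
      · have hav : a = q[h] := (List.idxOf_inj haq).1 (e'.trans hv.symm)
        by_cases hxq : x ∈ q
        · exact List.mem_append_left _ hxq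
        · exact List.mem_append_right _ ((hlmem x).2 ⟨hav ▸ hx, hxq⟩)
      · exact List.mem_append_left _ (H.closed a haq h2 x hx)
    · omega
  · intro a ha
    rcases hmem ha with ⟨haq, e, h1⟩ | ⟨hal, haq, e⟩
    · simpa [haq, e] using H.le a haq
    · simp only [haq, if_false]
      omega
  · intro a ha
    rcases hmem ha with ⟨haq, e, h1⟩ | ⟨hal, haq, e⟩
    · have := H.bound a haq
      simp only [haq, if_true]
      omega
    · simp only [haq, if_false]
      omega
  · intro a ha hlt
    rcases hmem ha with ⟨haq, e, h1⟩ | ⟨hal, haq, e⟩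
    · simp only [haq, e, if_true] at hlt ⊢
      obtain ⟨p, hp, hp1, hp2⟩ := H.parent a haq hlt
      exact ⟨p, List.mem_append_left _ hp, (idxOf_append_left hp).trans hp1, hp2⟩
    · have hvq : q[h] ∈ q := List.getElem_mem hh
      refine ⟨q[h], List.mem_append_left _ hvq, ?_, ((hlmem a).1 hal).1⟩
      simp only [haq, if_false, idxOf_append_left hvq, hv]
  · intro a ha x hx
    rcases hmem ha with ⟨haq, e, h1⟩ | ⟨hal, haq, e⟩
    · simp only [haq, if_true]
      by_cases hxq : x ∈ q
      · rw [idxOf_append_left hxq]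
        exact H.first a haq x hx
      · rw [idxOf_append_right hxq]
        have := H.le a haq
        omega
    · simp only [haq, if_false]
      by_cases hxq : x ∈ q
      · rw [idxOf_append_left hxq]
        by_contra! hlt
        exact haq (H.closed x hxq hlt a hx)
      · rw [idxOf_append_right hxq]
        omega
  · intro a ha b hb hab
    rcases hmem ha with ⟨haq, e, h1⟩ | ⟨hal, haq, e⟩ <;>
      rcases hmem hb with ⟨hbq, e', h2⟩ | ⟨hbl, hbq, e'⟩
    · simp only [haq, hbq, if_true]
      exact H.mono a haq b hbq (by omega)
    · simp only [haq, hbq, if_true, if_false]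
      have := H.bound a haq
      omega
    · omega
    · simp only [haq, hbq, if_false, le_refl]
  · intro a ha b hb hab hm hlt
    rcases hmem ha with ⟨haq, e, h1⟩ | ⟨hal, haq, e⟩ <;>
      rcases hmem hb with ⟨hbq, e', h2⟩ | ⟨hbl, hbq, e'⟩
    · simp only [haq, hbq, if_true] at hm hlt
      exact H.tie a haq b hbq (by omega) hm (by omega)
    · simp only [haq, hbq, if_true, if_false] at hm hlt
      have := H.bound a haq
      omega
    · omega
    · have h1 := List.idxOf_lt_length_iff.2 hal
      have h2 := List.idxOf_lt_length_iff.2 hbl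
      have := List.pairwise_iff_getElem.1 hsort _ _ h1 h2 (by omega)
      simpa using this
  · intro a ha hm x hx
    rcases hmem ha with ⟨haq, e, h1⟩ | ⟨hal, haq, e⟩
    · simp only [haq, if_true, e] at hm
      obtain ⟨h2, h3⟩ := H.source a haq hm x hx
      exact ⟨List.mem_append_left _ h2, by rw [idxOf_append_left h2, e]; exact h3⟩
    · simp only [haq, if_false] at hm
      omega

theorem isBfsOrder (H : PartialBfs G (fun v => (G.neighborSet v).ncard) R src q m h)
    (hall : ∀ a, a ∈ q) : IsBfsOrder G R q.idxOf m where
  inj := fun a b hab => (List.idxOf_inj (hall a)).1 hab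
  le := fun a => H.le a (hall a)
  parent := fun a ha => by
    obtain ⟨p, -, hp⟩ := H.parent a (hall a) ha
    exact ⟨p, hp⟩
  first := fun x a hx => H.first a (hall a) x hx
  mono := fun a b => H.mono a (hall a) b (hall b)
  tie := fun a b => H.tie a (hall a) b (hall b)

end PartialBfs

end PartialBfs

/-! ### Breadth-first search on the machine -/

section

variable {n : ℕ} {G : SimpleGraph (Fin n)} {A : AdjLists G}

/-- Handle the vertex at the head of the queue. -/
def visit (up : Bool) : Prog :=
  .line [.load 8 2 6, .inc 6, .copy 14 7] ;; gather ;;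
  .line (if up then [] else [.copy 14 7]) ;; peel up

/-- Append the next source to the queue unless it is marked. -/
def takeSource : Prog :=
  .line [.load 8 4 5, .inc 5, .load 12 5 8] ;;
  .cond (.eq 12 3) (.line [.store 5 8 4, .store 2 7 8, .inc 7]) (.line [])

/-- Breadth-first search. -/
def search (up : Bool) : Prog :=
  .line [.lit 5 0, .lit 6 0, .lit 7 0] ;;
  .loop (.lt 5 0) (.cond (.lt 6 7) (visit up) takeSource)

/-- The state of a breadth-first search with queue `q` and remaining sources `rest`. -/
structure SearchState (A : AdjLists G) (up : Bool) (k : ℕ) (src : List (Fin n)) (s : Mem)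
    (rest q : List (Fin n)) (m : Fin n → ℕ) : Prop where
  input : HoldsInput A k s
  degree : ∀ v : Fin n, s.arr 7 v = A.deg v
  remaining : s.var 5 + rest.length = n
  sources : Seg (s.arr 4) (s.var 5) rest
  taken : ∃ l, src = l ++ rest ∧ ∀ x ∈ l, x ∈ q
  bfs : PartialBfs G A.deg (DegreeRel up) src q m (s.var 6)
  tail : s.var 7 = q.length
  queue : Seg (s.arr 2) 0 q
  mark : ∀ w : Fin n, s.arr 5 w = if w ∈ q then 1 else 0

/-- Potential: 24 times the weight of the handled vertices plus 17 times that of the queue. The 17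
pays for sorting new vertices; the 24 covers the 11 for reading the adjacency list and 13 steps of
overhead, among them the two tests of `search` that precede the visit and appear as `c + 2`. -/
theorem runs_visit {up : Bool} {k c : ℕ} {src rest q : List (Fin n)} {m : Fin n → ℕ} {s : Mem}
    (H : SearchState A up k src s rest q m) (hlt : s.var 6 < q.length)
    (hc : 24 * (2 * G.edgeSet.ncard + n) + 17 * (2 * G.edgeSet.ncard + n) ≤
      c + 2 + 24 * A.weight (q.take (s.var 6)) + 17 * A.weight q) :
    Runs (visit up) s c fun s' c' => ∃ q' m', SearchState A up k src s' rest q' m' ∧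
      s'.var 5 = s.var 5 ∧
      c + 2 + 24 * A.weight (q.take (s.var 6)) + 17 * A.weight q ≤
        c' + 24 * A.weight (q'.take (s'.var 6)) + 17 * A.weight q' := by
  set v := q[s.var 6] with hv
  set l := (A.nbrs v).filter (· ∉ q) with hl
  have hv2 : s.arr 2 (s.var 6) = v := by
    simpa using seg_iff.1 H.queue (s.var 6) hlt
  have htake : q.take (s.var 6 + 1) = q.take (s.var 6) ++ [v] :=
    List.take_succ_eq_append_getElem hlt
  have hlnd : l.Nodup := (A.nodup v).filter _
  have hlmem : ∀ x, x ∈ l ↔ G.Adj v x ∧ x ∉ q := fun x => by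
    rw [hl, List.mem_filter, A.mem_nbrs]; simp
  have hql : (q ++ l).Nodup := by
    rw [List.nodup_append]
    refine ⟨H.bfs.nodup, hlnd, fun a ha b hb => ?_⟩
    rintro rfl
    exact ((hlmem a).1 hb).2 ha
  have hw1 := A.weight_le hql
  have hw2 := A.weight_le (H.bfs.nodup.sublist (List.take_sublist (s.var 6 + 1) q))
  rw [htake] at hw2
  simp only [AdjLists.weight_append, AdjLists.weight_cons, AdjLists.weight_nil, add_zero]
    at hw1 hw2
  refine Runs.seq (Runs.line (by simp; omega) ?_)
  set s1 := List.foldl (fun s i => Instr.apply i s) s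
    [Instr.load 8 2 6, Instr.inc 6, Instr.copy 14 7] with hs1
  have hI1 : HoldsInput A k s1 := H.input.congr (by simp [hs1, Instr.apply])
    (by simp [hs1, Instr.apply]) (by simp [hs1, Instr.apply]) (by simp [hs1, Instr.apply])
    (by simp [hs1, Instr.apply]) (by simp [hs1, Instr.apply])
  have ha1 : s1.arr = s.arr := by simp [hs1, Instr.apply]
  have h51 : s1.var 5 = s.var 5 := by simp [hs1, Instr.apply]
  have h61 : s1.var 6 = s.var 6 + 1 := by simp [hs1, Instr.apply]
  have h141 : s1.var 14 = q.length := by simp [hs1, Instr.apply, H.tail]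
  refine Runs.seq ((runs_gather hI1 (v := v) (q := q) (by simp [hs1, Instr.apply, hv2])
    (by simp [hs1, Instr.apply, H.tail]) (by rw [ha1]; exact H.mark)
    (by simp; omega)).mono ?_)
  rintro s2 c2 ⟨hI2, ⟨g1, g2, g3, g4, g5, g6⟩, hc2, l', hl', h13, h7, h6, h5⟩
  rw [← hl] at hl'
  subst hl'
  simp only [List.length_cons, List.length_nil] at hc2
  have hlen : (if up then [] else [Instr.copy 14 7]).length ≤ 1 := by cases up <;> simp
  refine Runs.seq (Runs.line (by omega) ?_)
  set s3 := List.foldl (fun s i => Instr.apply i s) s2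
    (if up then [] else [Instr.copy 14 7]) with hs3
  have hv3 : ∀ x, x ≠ 14 → s3.var x = s2.var x := by
    intro x hx
    cases up <;> simp [hs3, Instr.apply, hx]
  have ha3 : s3.arr = s2.arr := by cases up <;> simp [hs3, Instr.apply]
  have h143 : s3.var 14 = if up then q.length else q.length + l.length := by
    cases up
    · simp [hs3, Instr.apply, h7]
    · simp [hs3, g3, h141]
  refine (runs_peel (up := up) (l := l) (base := q.length)
    (hI2.congr (hv3 _ (by simp)) (hv3 _ (by simp)) (hv3 _ (by simp)) (hv3 _ (by simp))
      (by rw [ha3]) (by rw [ha3])) ?_ ((hv3 13 (by simp)).trans h13) (by rw [ha3]; exact h6)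
      h143 (by omega)).mono ?_
  · rw [ha3, g6, ha1]
    exact H.degree
  rintro s4 c4 ⟨hI4, ⟨p1, p2, p3, p4, p5, p6⟩, hc4, hbelow, o, hperm, hsort, hseg⟩
  have h64 : s4.var 6 = s.var 6 + 1 := by rw [p2, hv3 6 (by simp), g2, h61]
  have h54 : s4.var 5 = s.var 5 := by rw [p1, hv3 5 (by simp), g1, h51]
  have harr : ∀ a, s2.arr a = s1.arr a → s3.arr a = s.arr a := fun a h => by rw [ha3, h, ha1]
  have hbfs := H.bfs.visit_step hlt (hperm.nodup_iff.2 hlnd)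
    (fun x => hperm.mem_iff.trans (hlmem x)) hsort
  refine ⟨q ++ o, _, ⟨hI4, ?_, ?_, ?_, ?_, h64 ▸ hbfs, ?_, ?_, ?_⟩, h54, ?_⟩
  · rw [p6, harr 7 g6]; exact H.degree
  · rw [h54]; exact H.remaining
  · rw [h54, p4, harr 4 g5]; exact H.sources
  · obtain ⟨t, ht, ht'⟩ := H.taken
    exact ⟨t, ht, fun x hx => List.mem_append_left _ (ht' x hx)⟩
  · rw [p3, hv3 7 (by simp), h7, List.length_append, hperm.length_eq]
  · rw [seg_append]
    refine ⟨H.queue.congr fun j _ hj => ?_, by simpa using hseg⟩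
    rw [hbelow j (by omega), harr 2 g4]
  · intro w
    rw [p5, ha3, h5]
    simp only [List.mem_append, hperm.mem_iff]
  · rw [h64, List.take_append_of_le_length hlt, htake]
    simp only [AdjLists.weight_append, AdjLists.weight_cons, AdjLists.weight_nil,
      A.weight_perm hperm]
    omega

theorem runs_takeSource {up : Bool} {k c : ℕ} {src rest q : List (Fin n)} {m : Fin n → ℕ}
    {s : Mem} (H : SearchState A up k src s rest q m) (hle : q.length ≤ s.var 6)
    (hlt : s.var 5 < n) (hc : 9 ≤ c) :
    Runs takeSource s c fun s' c' => ∃ rest' q' m', SearchState A up k src s' rest' q' m' ∧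
      s'.var 5 = s.var 5 + 1 ∧ c ≤ c' + 9 ∧
      A.weight (q.take (s.var 6)) = A.weight (q'.take (s'.var 6)) ∧
      A.weight q ≤ A.weight q' := by
  have hh : s.var 6 = q.length := le_antisymm H.bfs.le_length hle
  have hrem := H.remaining
  have hsrc := H.sources
  obtain ⟨t, ht, ht'⟩ := H.taken
  obtain _ | ⟨w, rest⟩ := rest
  · simp at hrem
    omega
  obtain ⟨hw, hsrc⟩ := hsrc
  rw [List.length_cons] at hrem
  have ht2 : src = (t ++ [w]) ++ rest := by simp [ht]
  refine Runs.seq (Runs.line (by simp; omega) ?_)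
  by_cases hwq : w ∈ q
  · have h0 : s.arr 5 w = 1 := by simp [H.mark, hwq]
    refine Runs.cond (by simp; omega) ?_ fun _ => Runs.line (by simp; omega) ?_
    · intro h
      simp [Test.Holds, Instr.apply, hw, h0, H.input.zero] at h
    refine ⟨rest, q, m, ⟨H.input.congr ?_ ?_ ?_ ?_ ?_ ?_, ?_, ?_, ?_, ⟨t ++ [w], ht2, ?_⟩, ?_, ?_,
      ?_, ?_⟩, ?_, ?_, ?_, ?_⟩
    rotate_right 10
    · simpa [Instr.apply] using hsrc
    · intro x hx
      rcases List.mem_append.1 hx with hx | hx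
      · exact ht' x hx
      · rwa [List.mem_singleton.1 hx]
    · simpa [Instr.apply] using H.bfs
    · simpa [Instr.apply] using H.tail
    · simpa [Instr.apply] using H.queue
    · simpa [Instr.apply] using H.mark
    · simp [Instr.apply]
    · simp; omega
    · simp [Instr.apply]
    · exact le_rfl
    all_goals simp [Instr.apply, H.degree]
    omega
  · have h0 : s.arr 5 w = 0 := by simp [H.mark, hwq]
    refine Runs.cond (by simp; omega) (fun _ => Runs.line (by simp; omega) ?_) ?_
    swap
    · intro h
      simp [Test.Holds, Instr.apply, hw, h0, H.input.zero] at h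
    -- Whatever precedes `w` in `src` lies in the part `t` already taken, hence in the queue.
    have hbfs := H.bfs.source_step hh hwq fun x hx => ht' x (by
      by_contra hxt
      have hwt : w ∉ t := fun h => hwq (ht' w h)
      rw [ht, List.idxOf_append_of_notMem hxt, List.idxOf_append_of_notMem hwt] at hx
      simp at hx)
    refine ⟨rest, q ++ [w], _, ⟨H.input.congr ?_ ?_ ?_ ?_ ?_ ?_, ?_, ?_, ?_, ⟨t ++ [w], ht2, ?_⟩,
      hbfs, ?_, ?_, ?_⟩, ?_, ?_, ?_, ?_⟩
    rotate_right 9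
    · simpa [Instr.apply] using hsrc
    · intro x hx
      rcases List.mem_append.1 hx with hx | hx
      · exact List.mem_append_left _ (ht' x hx)
      · exact List.mem_append_right _ hx
    · simp [Instr.apply, H.tail]
    · exact H.queue.concat (by simp [Instr.apply, H.tail]) (by simp [Instr.apply, hw])
    · intro x
      by_cases hx : x = w
      · simp [Instr.apply, hw, hx, H.input.one]
      · have hx' : (x : ℕ) ≠ w := fun e => hx (Fin.ext e)
        simp [Instr.apply, hw, hx, hx', H.mark]
    · simp [Instr.apply]
    · simp; omega
    · simp [Instr.apply, hh]
    · simp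
    all_goals simp [Instr.apply, H.degree]
    omega

theorem runs_search {up : Bool} {k c : ℕ} {s : Mem} {src : List (Fin n)}
    (hI : HoldsInput A k s) (hdeg : ∀ v : Fin n, s.arr 7 v = A.deg v) (hlen : src.length = n)
    (hall : ∀ x, x ∈ src) (hsrc : Seg (s.arr 4) 0 src) (hmark : ∀ v : Fin n, s.arr 5 v = 0)
    (hc : 100 * (G.edgeSet.ncard + n + 1) ≤ c) :
    Runs (search up) s c fun s' c' => HoldsInput A k s' ∧ (∀ v : Fin n, s'.arr 7 v = A.deg v) ∧
      c ≤ c' + 100 * (G.edgeSet.ncard + n + 1) ∧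
      ∃ q m h, PartialBfs G A.deg (DegreeRel up) src q m h ∧ (∀ x, x ∈ q) ∧
        Seg (s'.arr 2) 0 q := by
  refine Runs.seq (Runs.line (by simp; omega) ?_)
  have hwle : ∀ {rest q : List (Fin n)} {m : Fin n → ℕ} {s' : Mem},
      SearchState A up k src s' rest q m → A.weight q ≤ 2 * G.edgeSet.ncard + n ∧
        A.weight (q.take (s'.var 6)) ≤ 2 * G.edgeSet.ncard + n ∧ s'.var 5 ≤ n := fun H =>
    ⟨A.weight_le H.bfs.nodup, A.weight_le (H.bfs.nodup.sublist (List.take_sublist _ _)), by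
      have := H.remaining
      omega⟩
  -- Each source adds 11 to the potential: the 9 steps of `takeSource` and two tests.
  refine Runs.loop (fun s' c' => ∃ rest q m, SearchState A up k src s' rest q m ∧
    c ≤ c' + 4 + 24 * A.weight (q.take (s'.var 6)) + 17 * A.weight q + 11 * s'.var 5) ?_ ?_ ?_ ?_
  · rintro s' c' ⟨rest, q, m, H, hc'⟩
    obtain ⟨h1, h2, h3⟩ := hwle H
    omega
  · rintro s' c' ⟨rest, q, m, H, hc'⟩ hb
    obtain ⟨h1, h2, h3⟩ := hwle H
    simp only [Test.Holds, H.input.size] at hb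
    refine Runs.cond (by omega) (fun h => ?_) (fun h => ?_)
    · simp only [Test.Holds, H.tail] at h
      refine (runs_visit H h (by omega)).mono ?_
      rintro s'' c'' ⟨q', m', H', h5, hc''⟩
      exact ⟨rest, q', m', H', by omega⟩
    · simp only [Test.Holds, H.tail, not_lt] at h
      refine (runs_takeSource H h hb (by omega)).mono ?_
      rintro s'' c'' ⟨rest', q', m', H', h5, hc'', hw1, hw2⟩
      exact ⟨rest', q', m', H', by omega⟩
  · rintro s' c' ⟨rest, q, m, H, hc'⟩ hb
    obtain ⟨h1, h2, h3⟩ := hwle H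
    simp only [Test.Holds, H.input.size] at hb
    have hrem := H.remaining
    have hrest : rest = [] := List.length_eq_zero_iff.1 (by omega)
    obtain ⟨t, ht, ht'⟩ := H.taken
    -- The loop ends when the sources run out, even if the head has not reached the tail. Every
    -- vertex is a source and is therefore in the queue by then.
    refine ⟨H.input, H.degree, by omega, q, m, _, H.bfs, fun x => ht' x ?_, H.queue⟩
    have := hall x
    rwa [ht, hrest, List.append_nil] at this
  · refine ⟨src, [], fun _ => 0, ⟨hI.congr ?_ ?_ ?_ ?_ ?_ ?_, ?_, ?_, ?_, ⟨[], rfl, by simp⟩, ?_,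
      ?_, seg_nil, ?_⟩, ?_⟩
    rotate_right 6
    · simpa [Instr.apply] using hlen
    · simpa [Instr.apply] using hsrc
    · simpa [Instr.apply] using PartialBfs.nil G A.deg (DegreeRel up) src fun _ => 0
    · simp [Instr.apply]
    · simp [Instr.apply, hmark]
    · simp [Instr.apply]; omega
    all_goals simp [Instr.apply, hdeg]

/-! ### The whole program and its remaining phases -/

/-- Compute the degrees, and list all the vertices as sources. -/
def setup : Prog :=
  .line [.lit 4 1, .lit 5 0] ;;
  .loop (.lt 5 0)
    (.line (.copy 8 5 :: openList ++ [.lit 17 0]) ;;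
     .loop (.lt 9 10) (.line [.inc 9, .inc 17]) ;;
     .line [.store 7 5 17, .store 4 5 5, .inc 5])

/-- Copy the queue, reversed, to the list of sources, and remove all marks. -/
def reverseQueue : Prog :=
  .line [.lit 5 0, .copy 7 0] ;;
  .loop (.lt 5 0) (.line [.dec 7, .load 12 2 5, .store 4 7 12, .store 5 5 3, .inc 5])

/-- Color the vertices cyclically in the order of the queue. -/
def color : Prog :=
  .line [.lit 5 0, .lit 13 0] ;;
  .loop (.lt 5 0)
    (.line [.load 8 2 5, .store 3 8 13, .inc 5, .inc 13] ;;
     .cond (.eq 13 1) (.line [.lit 13 0]) (.line []))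

/-- Set the answer to NO if the vertex in variable 11 is on the open adjacency list. -/
def scan : Prog :=
  .loop (.lt 9 10)
    (.line [.load 12 1 9, .inc 9] ;; .cond (.eq 12 11) (.line [.lit 2 0]) (.line []))

/-- Let variable 16 be twice the smaller one of the number of colors and of vertices. -/
def doubleColors : Prog :=
  .line [.lit 2 1, .lit 13 0, .lit 16 0] ;;
  .cond (.lt 1 0) (.line [.copy 17 1]) (.line [.copy 17 0]) ;;
  .loop (.lt 13 17) (.line [.inc 13, .inc 16, .inc 16]) ;;
  .line [.lit 5 0]

/-- Answer NO if some vertex is adjacent to the one that comes `2 * k` places later. -/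
def answer : Prog :=
  doubleColors ;;
  .loop (.lt 16 0)
    (.line (.load 8 2 5 :: .load 11 2 16 :: openList) ;; scan ;; .line [.inc 5, .inc 16])

/-- The whole algorithm. -/
def equitableTreeColoring : Prog :=
  setup ;; search false ;; reverseQueue ;; search true ;; color ;; answer

theorem HoldsInput.foldl_openList {k : ℕ} {s : Mem} (hI : HoldsInput A k s) {v : Fin n}
    (hv : s.var 8 = v) {s' : Mem} (hs' : s' = openList.foldl (fun s i => i.apply s) s) :
    Seg (s'.arr 1) (s'.var 9) (A.nbrs v) ∧ s'.var 10 = s'.var 9 + A.deg v ∧ s'.arr = s.arr ∧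
      ∀ x, x ≠ 9 → x ≠ 10 → x ≠ 12 → s'.var x = s.var x := by
  subst hs'
  refine ⟨?_, ?_, ?_, fun x h1 h2 h3 => ?_⟩
  · simp [openList, Instr.apply, hv, hI.start]
  · simp [openList, Instr.apply, hv, hI.finish]
  · simp [openList, Instr.apply]
  · simp [openList, Instr.apply, h1, h2, h3]

theorem AdjLists.weight_take_succ (A : AdjLists G) (f : Fin n → Fin n) {i : ℕ} (hi : i < n) :
    A.weight (((List.finRange n).map f).take (i + 1)) =
      A.weight (((List.finRange n).map f).take i) + (A.deg (f ⟨i, hi⟩) + 1) := by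
  rw [List.take_succ_eq_append_getElem (by simpa using hi), AdjLists.weight_append]
  simp

theorem AdjLists.weight_take_le (A : AdjLists G) {f : Fin n → Fin n}
    (hf : Function.Injective f) (i : ℕ) :
    A.weight (((List.finRange n).map f).take i) ≤ 2 * G.edgeSet.ncard + n :=
  A.weight_le (((List.nodup_finRange n).map hf).sublist (List.take_sublist _ _))

theorem runs_count {s : Mem} {d c : ℕ} (h : s.var 10 = s.var 9 + d) (h17 : s.var 17 = 0)
    (hc : 4 * d + 1 ≤ c) :
    Runs (.loop (.lt 9 10) (.line [.inc 9, .inc 17])) s c fun s' c' =>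
      s'.var 17 = d ∧ s'.arr = s.arr ∧ (∀ x, x ≠ 9 → x ≠ 17 → s'.var x = s.var x) ∧
        c ≤ c' + (4 * d + 1) := by
  refine Runs.loop (fun s' c' => s'.arr = s.arr ∧
    (∀ x, x ≠ 9 → x ≠ 17 → s'.var x = s.var x) ∧ s'.var 9 = s.var 9 + s'.var 17 ∧
    s'.var 17 ≤ d ∧ c ≤ c' + 4 * s'.var 17) ?_ ?_ ?_ ?_
  · rintro s' c' ⟨-, -, -, h1, h2⟩
    omega
  · rintro s' c' ⟨ha, hv, h9, h1, h2⟩ hb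
    simp only [Test.Holds, hv 10 (by simp) (by simp), h9, h] at hb
    refine Runs.line (by simp; omega) ⟨?_, fun x hx1 hx2 => ?_, ?_, ?_, ?_⟩
    · simp [Instr.apply, ha]
    · simp [Instr.apply, hx1, hx2, hv x hx1 hx2]
    all_goals simp [Instr.apply, h9]
    all_goals omega
  · rintro s' c' ⟨ha, hv, h9, h1, h2⟩ hb
    simp only [Test.Holds, hv 10 (by simp) (by simp), h9, h] at hb
    exact ⟨by omega, ha, hv, by omega⟩
  · simp [h17]

theorem runs_setup (k : ℕ) {c : ℕ} (hc : 40 * (G.edgeSet.ncard + n + 1) ≤ c) :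
    Runs setup (A.input k) c fun s c' => HoldsInput A k s ∧
      (∀ v : Fin n, s.arr 7 v = A.deg v) ∧ Seg (s.arr 4) 0 (List.finRange n) ∧
      (∀ v : Fin n, s.arr 5 v = 0) ∧ c ≤ c' + 40 * (G.edgeSet.ncard + n + 1) := by
  refine Runs.seq (Runs.line (by simp; omega) ?_)
  refine Runs.loop (fun s c' => HoldsInput A k s ∧ s.var 5 ≤ n ∧
    (∀ v : Fin n, (v : ℕ) < s.var 5 → s.arr 7 v = A.deg v ∧ s.arr 4 v = v) ∧
    (∀ v : Fin n, s.arr 5 v = 0) ∧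
    c ≤ c' + 3 + 13 * A.weight (((List.finRange n).map id).take (s.var 5))) ?_ ?_ ?_ ?_
  · rintro s c' ⟨-, -, -, -, h⟩
    have := A.weight_take_le Function.injective_id (s.var 5)
    omega
  · rintro s c' ⟨hI, hn, hd, h0, h⟩ hb
    simp only [Test.Holds, hI.size] at hb
    have hw := A.weight_take_le Function.injective_id (s.var 5 + 1)
    rw [A.weight_take_succ _ hb] at hw
    set v : Fin n := ⟨s.var 5, hb⟩ with hv
    simp only [id] at hw
    refine Runs.seq (Runs.line (by simp [openList]; omega) ?_)
    rw [List.cons_append, List.foldl_cons, List.foldl_append]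
    obtain ⟨-, o2, o3, o4⟩ := HoldsInput.foldl_openList (A := A) (k := k) (v := v)
      (s := (Instr.copy 8 5).apply s) (hI.congr (by simp [Instr.apply]) (by simp [Instr.apply])
        (by simp [Instr.apply]) (by simp [Instr.apply]) (by simp [Instr.apply])
        (by simp [Instr.apply])) (by simp [Instr.apply, hv]) rfl
    set s1 := openList.foldl (fun s i => i.apply s) ((Instr.copy 8 5).apply s) with hs1
    refine Runs.seq ((runs_count (d := A.deg v) (by simpa [Instr.apply] using o2)
      (by simp [Instr.apply]) (by simp [openList]; omega)).mono ?_)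
    rintro s2 c2 ⟨h17, ha, hv2, hc2⟩
    simp only [List.length_cons, List.length_append, List.length_nil, openList] at hc2
    have ha2 : s2.arr = s.arr := by rw [ha]; simp [Instr.apply, o3]
    have hv3 : ∀ x, x ≠ 8 → x ≠ 9 → x ≠ 10 → x ≠ 12 → x ≠ 17 → s2.var x = s.var x := by
      intro x h1 h2 h3 h4 h5
      rw [hv2 x h2 h5]
      simp [Instr.apply, h5, o4 x h2 h3 h4, h1]
    have hI2 : HoldsInput A k s2 := by
      refine hI.congr ?_ ?_ ?_ ?_ (by rw [ha2]) (by rw [ha2])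
      all_goals exact hv3 _ (by simp) (by simp) (by simp) (by simp) (by simp)
    have h52 : s2.var 5 = s.var 5 := hv3 _ (by simp) (by simp) (by simp) (by simp) (by simp)
    refine Runs.line (by simp; omega) ⟨hI2.congr ?_ ?_ ?_ ?_ ?_ ?_, ?_, ?_, ?_, ?_⟩
    rotate_right 4
    · simp [Instr.apply, h52]; omega
    · intro x hx
      simp only [Instr.apply, List.foldl, h52, Function.update_self] at hx
      by_cases hxv : (x : ℕ) = s.var 5
      · have : x = v := Fin.ext hxv
        rw [this]
        simp [Instr.apply, h52, h17, hv]
      · simpa [Instr.apply, h52, hxv, ha2] using hd x (by omega)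
    · simpa [Instr.apply, ha2] using h0
    · simp only [Instr.apply, List.foldl, h52, Function.update_self]
      rw [A.weight_take_succ _ hb, ← hv, id]
      simp only [List.length_cons, List.length_nil]
      omega
    all_goals simp [Instr.apply]
  · rintro s c' ⟨hI, hn, hd, h0, h⟩ hb
    simp only [Test.Holds, hI.size] at hb
    have hw := A.weight_take_le Function.injective_id (s.var 5)
    refine ⟨hI, fun v => (hd v (by omega)).1, ?_, h0, by omega⟩
    rw [seg_iff]
    intro i hi
    have hi' : i < n := by simpa using hi
    simpa using (hd ⟨i, hi'⟩ (by simp only; omega)).2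
  · refine ⟨(holdsInput_init A k).congr ?_ ?_ ?_ ?_ ?_ ?_, ?_, ?_, ?_, ?_⟩
    all_goals simp [Instr.apply, AdjLists.input]
    omega

theorem runs_reverseQueue {k c : ℕ} {s : Mem} (hI : HoldsInput A k s) {q : List (Fin n)}
    (hq : Seg (s.arr 2) 0 q) (hlen : q.length = n) (hc : 10 * (n + 1) ≤ c) :
    Runs reverseQueue s c fun s' c' => HoldsInput A k s' ∧ s'.arr 7 = s.arr 7 ∧
      Seg (s'.arr 4) 0 q.reverse ∧ (∀ v : Fin n, s'.arr 5 v = 0) ∧ c ≤ c' + 10 * (n + 1) := by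
  refine Runs.seq (Runs.line (by simp; omega) ?_)
  refine Runs.loop (fun s' c' => HoldsInput A k s' ∧ s'.arr 7 = s.arr 7 ∧
    (∃ l r, q = l ++ r ∧ s'.var 5 = l.length ∧ s'.var 7 = r.length ∧
      Seg (s'.arr 2) (s'.var 5) r ∧ Seg (s'.arr 4) (s'.var 7) l.reverse) ∧
    (∀ j < s'.var 5, s'.arr 5 j = 0) ∧ c ≤ c' + 3 + 7 * s'.var 5) ?_ ?_ ?_ ?_
  · rintro s' c' ⟨-, -, ⟨l, r, hlr, h5, -⟩, -, h⟩
    have := congrArg List.length hlr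
    rw [List.length_append] at this
    omega
  · rintro s' c' ⟨hI', h7, ⟨l, r, hlr, hl, hr, hs2, hs4⟩, h0, h⟩ hb
    have hll := congrArg List.length hlr
    rw [List.length_append] at hll
    simp only [Test.Holds, hI'.size] at hb
    obtain _ | ⟨w, r⟩ := r
    · simp at hll
      omega
    obtain ⟨hw, hs2⟩ := hs2
    rw [List.length_cons] at hr hll
    have hr' : s'.var 7 = s'.var 7 - 1 + 1 := by omega
    refine Runs.line (by simp; omega) ⟨hI'.congr ?_ ?_ ?_ ?_ ?_ ?_, ?_,
      ⟨l ++ [w], r, by simp [hlr], ?_, ?_, ?_, ?_⟩, ?_, ?_⟩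
    rotate_right 6
    · simp [Instr.apply, hl]
    · simp [Instr.apply, hr]
    · simpa [Instr.apply] using hs2
    · rw [hr'] at hs4
      simpa [Instr.apply] using hs4.update_cons hw
    · intro j hj
      simp only [Instr.apply, List.foldl, Function.update_self] at hj
      by_cases hj' : j = s'.var 5
      · simp [Instr.apply, hj', hI'.zero]
      · simpa [Instr.apply, hj'] using h0 j (by simp at hj; omega)
    · simp [Instr.apply]; omega
    all_goals simp [Instr.apply, h7]
  · rintro s' c' ⟨hI', h7, ⟨l, r, hlr, hl, hr, hs2, hs4⟩, h0, h⟩ hb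
    have hll := congrArg List.length hlr
    rw [List.length_append] at hll
    simp only [Test.Holds, hI'.size] at hb
    have hr0 : r = [] := List.length_eq_zero_iff.1 (by omega)
    subst hr0
    rw [hr, ← List.append_nil l, ← hlr] at hs4
    exact ⟨hI', h7, hs4, fun v => h0 v (by have := v.2; omega), by omega⟩
  · refine ⟨hI.congr ?_ ?_ ?_ ?_ ?_ ?_, ?_, ⟨[], q, rfl, ?_, ?_, ?_, ?_⟩, ?_, ?_⟩
    all_goals simp [Instr.apply, hI.size, hlen, hq, seg_nil]
    omega

theorem succ_mod {k : ℕ} (hk : 0 < k) (i : ℕ) :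
    (i + 1) % k = if i % k + 1 = k then 0 else i % k + 1 := by
  have hlt := Nat.mod_lt i hk
  rw [← Nat.mod_add_mod]
  split_ifs with h
  · rw [h, Nat.mod_self]
  · exact Nat.mod_eq_of_lt (by omega)

/-- The machine has no division: residues come from a counter that is reset on reaching `k`. -/
theorem runs_color {k c : ℕ} {s : Mem} (hk : 0 < k) (hI : HoldsInput A k s)
    {σ : Equiv.Perm (Fin n)} (hσ : s.ListsOrder σ) (hc : 10 * (n + 1) ≤ c) :
    Runs color s c fun s' c' => HoldsInput A k s' ∧ s'.ListsOrder σ ∧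
      s'.GivesColoring (modColoring hk σ) ∧ c ≤ c' + 10 * (n + 1) := by
  refine Runs.seq (Runs.line (by simp; omega) ?_)
  refine Runs.loop (fun s' c' => HoldsInput A k s' ∧ s'.ListsOrder σ ∧ s'.var 5 ≤ n ∧
    s'.var 13 = s'.var 5 % k ∧ (∀ j : Fin n, (j : ℕ) < s'.var 5 → s'.arr 3 (σ j) = j % k) ∧
    c ≤ c' + 3 + 9 * s'.var 5) ?_ ?_ ?_ ?_
  · rintro s' c' ⟨-, -, h5, -, -, h⟩
    omega
  · rintro s' c' ⟨hI', hσ', h5, h13, h3, h⟩ hb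
    simp only [Test.Holds, hI'.size] at hb
    have hv : s'.arr 2 (s'.var 5) = σ ⟨s'.var 5, hb⟩ := hσ' ⟨s'.var 5, hb⟩
    have hcol : ∀ j : Fin n, (j : ℕ) < s'.var 5 + 1 →
        Function.update (s'.arr 3) (σ ⟨s'.var 5, hb⟩) (s'.var 5 % k) (σ j) = j % k := by
      intro j hj
      by_cases hj' : j = ⟨s'.var 5, hb⟩
      · subst hj'
        simp
      · have h1 : (σ j : ℕ) ≠ σ ⟨s'.var 5, hb⟩ := fun e => hj' (σ.injective (Fin.ext e))
        rw [Function.update_of_ne h1]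
        exact h3 j (lt_of_le_of_ne (by omega) fun e => hj' (Fin.ext e))
    have hmod := succ_mod hk (s'.var 5)
    refine Runs.seq (Runs.line (by simp; omega) (Runs.cond (by simp; omega)
      (fun h => Runs.line (by simp; omega) ?_) (fun h => Runs.line (by simp; omega) ?_)))
    · have hm : s'.var 5 % k + 1 = k := by
        simpa [Test.Holds, Instr.apply, h13, hI'.colors] using h
      rw [if_pos hm] at hmod
      refine ⟨hI'.congr ?_ ?_ ?_ ?_ ?_ ?_, ?_, ?_, ?_, ?_, ?_⟩
      rotate_right 5
      · intro i
        simpa [Instr.apply] using hσ' i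
      · simp [Instr.apply]; omega
      · simp [Instr.apply, hmod]
      · simpa [Instr.apply, hv, h13] using hcol
      · simp [Instr.apply]; omega
      all_goals simp [Instr.apply]
    · have hm : ¬ s'.var 5 % k + 1 = k := by
        simpa [Test.Holds, Instr.apply, h13, hI'.colors] using h
      rw [if_neg hm] at hmod
      refine ⟨hI'.congr ?_ ?_ ?_ ?_ ?_ ?_, ?_, ?_, ?_, ?_, ?_⟩
      rotate_right 5
      · intro i
        simpa [Instr.apply] using hσ' i
      · simp [Instr.apply]; omega
      · simp [Instr.apply, hmod, h13]
      · simpa [Instr.apply, hv, h13] using hcol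
      · simp [Instr.apply]; omega
      all_goals simp [Instr.apply]
  · rintro s' c' ⟨hI', hσ', h5, h13, h3, h⟩ hb
    simp only [Test.Holds, hI'.size] at hb
    refine ⟨hI', hσ', fun v => ?_, by omega⟩
    have := h3 (σ.symm v) (by have := (σ.symm v).2; omega)
    simpa [modColoring] using this
  · refine ⟨hI.congr ?_ ?_ ?_ ?_ ?_ ?_, ?_, ?_, ?_, ?_, ?_⟩
    rotate_right 5
    · intro i
      simpa [Instr.apply] using hσ i
    all_goals simp [Instr.apply]
    omega

open Classical in
theorem runs_scan {c : ℕ} {s : Mem} {v u : Fin n} (hs : Seg (s.arr 1) (s.var 9) (A.nbrs v))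
    (hlast : s.var 10 = s.var 9 + A.deg v) (hu : s.var 11 = u) (hc : 7 * A.deg v + 1 ≤ c) :
    Runs scan s c fun s' c' => s'.arr = s.arr ∧
      (∀ x, x ≠ 2 → x ≠ 9 → x ≠ 12 → s'.var x = s.var x) ∧
      s'.var 2 = (if G.Adj v u then 0 else s.var 2) ∧ c ≤ c' + (7 * A.deg v + 1) := by
  refine Runs.loop (fun s' c' => s'.arr = s.arr ∧
    (∀ x, x ≠ 2 → x ≠ 9 → x ≠ 12 → s'.var x = s.var x) ∧
    ∃ l r, A.nbrs v = l ++ r ∧ Seg (s.arr 1) (s'.var 9) r ∧ s.var 10 = s'.var 9 + r.length ∧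
      s'.var 2 = (if u ∈ l then 0 else s.var 2) ∧ c ≤ c' + 7 * l.length) ?_ ?_ ?_ ?_
  · rintro s' c' ⟨-, -, l, r, hlr, -, -, -, h⟩
    have := congrArg List.length hlr
    rw [List.length_append] at this
    simp only [AdjLists.deg] at hc
    omega
  · rintro s' c' ⟨ha, hv, l, r, hlr, hr, h10, h2, h⟩ hb
    have hll := congrArg List.length hlr
    rw [List.length_append] at hll
    simp only [AdjLists.deg] at hc
    simp only [Test.Holds, hv 10 (by simp) (by simp) (by simp), h10] at hb
    obtain _ | ⟨w, r⟩ := r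
    · simp at hb
    obtain ⟨hw, hr⟩ := hr
    rw [List.length_cons] at h10 hll
    have hu' := (hv 11 (by simp) (by simp) (by simp)).trans hu
    refine Runs.seq (Runs.line (by simp; omega) (Runs.cond (by simp; omega)
      (fun h => Runs.line (by simp; omega) ?_) (fun h => Runs.line (by simp; omega) ?_)))
    · have hwu : w = u := by
        refine Fin.ext ?_
        simpa [Test.Holds, Instr.apply, ha, hw, hu'] using h
      refine ⟨by simp [Instr.apply, ha], fun x h1 h2 h3 => ?_, l ++ [w], r, by simp [hlr], ?_, ?_,
        ?_, ?_⟩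
      · simp [Instr.apply, h1, h2, h3, hv x h1 h2 h3]
      · simpa [Instr.apply] using hr
      · simp [Instr.apply, h10]; omega
      · simp [Instr.apply, hwu]
      · simp; omega
    · have hwu : u ≠ w := fun e => by
        simp [Test.Holds, Instr.apply, ha, hw, hu', e] at h
      refine ⟨by simp [Instr.apply, ha], fun x h1 h2 h3 => ?_, l ++ [w], r, by simp [hlr], ?_, ?_,
        ?_, ?_⟩
      · simp [Instr.apply, h2, h3, hv x h1 h2 h3]
      · simpa [Instr.apply] using hr
      · simp [Instr.apply, h10]; omega
      · simp [Instr.apply, hwu, h2]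
      · simp; omega
  · rintro s' c' ⟨ha, hv, l, r, hlr, hr, h10, h2, h⟩ hb
    have hll := congrArg List.length hlr
    rw [List.length_append] at hll
    simp only [AdjLists.deg] at hc ⊢
    simp only [Test.Holds, hv 10 (by simp) (by simp) (by simp), h10] at hb
    have hr0 : r = [] := List.length_eq_zero_iff.1 (by omega)
    subst hr0
    rw [List.append_nil] at hlr
    refine ⟨ha, hv, ?_, by omega⟩
    rw [h2, ← hlr]
    simp only [A.mem_nbrs]
  · exact ⟨rfl, fun _ _ _ _ => rfl, [], A.nbrs v, rfl, hs, hlast, by simp, by simp⟩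

/-- Counting up to `2 * k` would not be linear in the size of the graph, as `k` is arbitrary.
Capping `k` at `n` does no harm: two positions are never `2 * n` or more apart. -/
theorem runs_doubleColors {k c : ℕ} {s : Mem} (hI : HoldsInput A k s) (hc : 5 * n + 15 ≤ c) :
    Runs doubleColors s c fun s' c' => HoldsInput A k s' ∧ s'.arr = s.arr ∧ s'.var 2 = 1 ∧
      s'.var 5 = 0 ∧ s'.var 16 = 2 * min k n ∧ c ≤ c' + (5 * n + 15) := by
  refine Runs.seq (Runs.line (by simp; omega) ?_)
  have hcond : Runs (.cond (.lt 1 0) (.line [.copy 17 1]) (.line [.copy 17 0]))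
      (List.foldl (fun s i => Instr.apply i s) s [.lit 2 1, .lit 13 0, .lit 16 0]) (c - 4) fun s' c' =>
      HoldsInput A k s' ∧ s'.arr = s.arr ∧ s'.var 2 = 1 ∧ s'.var 13 = 0 ∧ s'.var 16 = 0 ∧
        s'.var 17 = min k n ∧ c ≤ c' + 7 := by
    refine Runs.cond (by omega)
      (fun h => Runs.line (by simp; omega) ⟨hI.congr ?_ ?_ ?_ ?_ ?_ ?_, ?_, ?_, ?_, ?_, ?_, ?_⟩)
      (fun h => Runs.line (by simp; omega) ⟨hI.congr ?_ ?_ ?_ ?_ ?_ ?_, ?_, ?_, ?_, ?_, ?_, ?_⟩)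
    all_goals simp [Test.Holds, Instr.apply, hI.size, hI.colors] at h
    all_goals simp [Instr.apply, hI.size, hI.colors]
    all_goals omega
  refine Runs.seq (hcond.mono ?_)
  rintro s1 c1 ⟨hI1, ha1, h2, h13, h16, h17, hc1⟩
  refine Runs.seq (Runs.loop (fun s' c' => HoldsInput A k s' ∧ s'.arr = s.arr ∧ s'.var 2 = 1 ∧
    s'.var 13 ≤ min k n ∧ s'.var 17 = min k n ∧ s'.var 16 = 2 * s'.var 13 ∧
    c ≤ c' + 7 + 5 * s'.var 13) ?_ ?_ ?_ ?_)
  · rintro s' c' ⟨-, -, -, h1, -, -, h⟩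
    omega
  · rintro s' c' ⟨hI', ha, h2, h13, h17, h16, h⟩ hb
    simp only [Test.Holds, h17] at hb
    refine Runs.line (by simp; omega) ⟨hI'.congr ?_ ?_ ?_ ?_ ?_ ?_, ?_, ?_, ?_, ?_, ?_, ?_⟩
    all_goals simp [Instr.apply, ha, h2, h17, h16]
    all_goals omega
  · rintro s' c' ⟨hI', ha, h2, h13, h17, h16, h⟩ hb
    simp only [Test.Holds, h17] at hb
    refine Runs.line (by simp; omega) ⟨hI'.congr ?_ ?_ ?_ ?_ ?_ ?_, ?_, ?_, ?_, ?_, ?_⟩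
    all_goals simp [Instr.apply, ha, h2, h16]
    all_goals omega
  · exact ⟨hI1, ha1, h2, by omega, h17, by omega, by omega⟩

open Classical in
theorem runs_answer {k c : ℕ} {s : Mem} (hI : HoldsInput A k s) {σ : Equiv.Perm (Fin n)}
    (hσ : s.ListsOrder σ) (hc : 50 * (G.edgeSet.ncard + n + 1) ≤ c) :
    Runs answer s c fun s' c' => s'.arr = s.arr ∧
      s'.var 2 = (if ∃ i j : Fin n, (j : ℕ) = i + 2 * k ∧ G.Adj (σ i) (σ j) then 0 else 1) ∧
      c ≤ c' + 50 * (G.edgeSet.ncard + n + 1) := by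
  refine Runs.seq ((runs_doubleColors hI (by omega)).mono ?_)
  rintro s1 c1 ⟨hI1, ha1, h21, h51, h161, hc1⟩
  refine Runs.loop (fun s' c' => HoldsInput A k s' ∧ s'.arr = s.arr ∧ s'.var 5 ≤ n ∧
    s'.var 16 = s'.var 5 + 2 * min k n ∧
    s'.var 2 = (if ∃ i j : Fin n, (i : ℕ) < s'.var 5 ∧ (j : ℕ) = i + 2 * k ∧
      G.Adj (σ i) (σ j) then 0 else 1) ∧
    c ≤ c' + (5 * n + 15) + 12 * A.weight (((List.finRange n).map σ).take (s'.var 5)))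
    ?_ ?_ ?_ ?_
  · rintro s' c' ⟨-, -, -, -, -, h⟩
    have := A.weight_take_le σ.injective (s'.var 5)
    omega
  · rintro s' c' ⟨hI', ha, h5, h16, h2, h⟩ hb
    simp only [Test.Holds, hI'.size] at hb
    have hi : s'.var 5 < n := by omega
    -- The loop test gives `2 * min k n < n`, so the cap is not in effect once the loop is entered.
    have hmin : min k n = k := by omega
    rw [hmin] at h16
    have hw := A.weight_take_le σ.injective (s'.var 5 + 1)
    have hws := A.weight_take_succ σ hi
    rw [hws] at hw
    set i : Fin n := ⟨s'.var 5, hi⟩ with hi'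
    set j : Fin n := ⟨s'.var 16, hb⟩ with hj'
    have hvi : s'.arr 2 (s'.var 5) = σ i := by rw [ha]; exact hσ i
    have hvj : s'.arr 2 (s'.var 16) = σ j := by rw [ha]; exact hσ j
    refine Runs.seq (Runs.line (by simp [openList]; omega) ?_)
    rw [List.foldl_cons, List.foldl_cons]
    obtain ⟨o1, o2, o3, o4⟩ := HoldsInput.foldl_openList (A := A) (k := k) (v := σ i)
      (s := (Instr.load 11 2 16).apply ((Instr.load 8 2 5).apply s'))
      (hI'.congr (by simp [Instr.apply]) (by simp [Instr.apply])
        (by simp [Instr.apply]) (by simp [Instr.apply]) (by simp [Instr.apply])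
        (by simp [Instr.apply])) (by simp [Instr.apply, hvi]) rfl
    set s2 := openList.foldl (fun s i => i.apply s)
      ((Instr.load 11 2 16).apply ((Instr.load 8 2 5).apply s')) with hs2
    have ha2 : s2.arr = s.arr := by rw [o3]; simp [Instr.apply, ha]
    have h11 : s2.var 11 = σ j := by
      rw [o4 11 (by simp) (by simp) (by simp)]; simp [Instr.apply, hvj]
    refine Runs.seq ((runs_scan (u := σ j) o1 o2 h11 (by simp [openList]; omega)).mono ?_)
    rintro s3 c3 ⟨ha3, hv3, h23, hc3⟩
    simp only [List.length_cons, List.length_nil, openList] at hc3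
    have hv : ∀ x, x ≠ 2 → x ≠ 8 → x ≠ 9 → x ≠ 10 → x ≠ 11 → x ≠ 12 →
        s3.var x = s'.var x := by
      intro x h1 h2 h3 h4 h5 h6
      rw [hv3 x h1 h3 h6, o4 x h3 h4 h6]
      simp [Instr.apply, h2, h5]
    have hI3 : HoldsInput A k s3 := by
      refine hI'.congr ?_ ?_ ?_ ?_ (by rw [ha3, ha2, ha]) (by rw [ha3, ha2, ha])
      all_goals exact hv _ (by simp) (by simp) (by simp) (by simp) (by simp) (by simp)
    have h53 : s3.var 5 = s'.var 5 :=
      hv _ (by simp) (by simp) (by simp) (by simp) (by simp) (by simp)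
    have h163 : s3.var 16 = s'.var 16 :=
      hv _ (by simp) (by simp) (by simp) (by simp) (by simp) (by simp)
    have h22 : s2.var 2 = s'.var 2 := by
      rw [o4 2 (by simp) (by simp) (by simp)]; simp [Instr.apply]
    have e5 : (List.foldl (fun s i => Instr.apply i s) s3 [.inc 5, .inc 16]).var 5 =
        s'.var 5 + 1 := by simp [Instr.apply, h53]
    have e2 : (List.foldl (fun s i => Instr.apply i s) s3 [.inc 5, .inc 16]).var 2 =
        s3.var 2 := by simp [Instr.apply]
    refine Runs.line (by simp; omega) ⟨hI3.congr ?_ ?_ ?_ ?_ ?_ ?_, ?_, ?_, ?_, ?_, ?_⟩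
    rotate_right 5
    · simp [Instr.apply, ha3, ha2]
    · simp [Instr.apply, h53]; omega
    · simp [Instr.apply, h53, h163, h16, hmin]; omega
    · have hiff : (∃ i j : Fin n, (i : ℕ) < s'.var 5 + 1 ∧ (j : ℕ) = i + 2 * k ∧
          G.Adj (σ i) (σ j)) ↔ G.Adj (σ i) (σ j) ∨ ∃ i j : Fin n, (i : ℕ) < s'.var 5 ∧
          (j : ℕ) = i + 2 * k ∧ G.Adj (σ i) (σ j) := by
        constructor
        · rintro ⟨a, b, hab, hb', hadj⟩
          rcases (Nat.lt_succ_iff.1 hab).eq_or_lt with e | hlt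
          · have e1 : a = i := Fin.ext e
            have e2 : b = j := Fin.ext (by rw [hb', e, hj']; exact h16.symm)
            rw [e1, e2] at hadj
            exact Or.inl hadj
          · exact Or.inr ⟨a, b, hlt, hb', hadj⟩
        · rintro (hadj | ⟨a, b, hab, hb', hadj⟩)
          · exact ⟨i, j, Nat.lt_succ_self _, h16, hadj⟩
          · exact ⟨a, b, by omega, hb', hadj⟩
      rw [e5, e2, h23, h22, h2]
      simp only [hiff]
      by_cases h1 : G.Adj (σ i) (σ j)
      · rw [if_pos h1, if_pos (Or.inl h1)]
      · simp only [h1, if_false, false_or]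
    · rw [e5, hws]
      simp only [List.length_cons, List.length_nil]
      omega
    all_goals simp [Instr.apply]
  · rintro s' c' ⟨hI', ha, h5, h16, h2, h⟩ hb
    simp only [Test.Holds, hI'.size] at hb
    have hw := A.weight_take_le σ.injective (s'.var 5)
    refine ⟨ha, ?_, by omega⟩
    rw [h2]
    have hiff : (∃ i j : Fin n, (i : ℕ) < s'.var 5 ∧ (j : ℕ) = i + 2 * k ∧ G.Adj (σ i) (σ j)) ↔
        ∃ i j : Fin n, (j : ℕ) = i + 2 * k ∧ G.Adj (σ i) (σ j) := by
      constructor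
      · rintro ⟨a, b, -, h⟩
        exact ⟨a, b, h⟩
      · rintro ⟨a, b, hab, h⟩
        have := a.2
        have := b.2
        exact ⟨a, b, by omega, hab, h⟩
    simp only [hiff]
  · exact ⟨hI1, ha1, by omega, by omega, by simp [h51, h21], by simp [h51]; omega⟩

end

/-! ### From lists of all vertices to permutations -/

section Permutation

variable {n : ℕ}

theorem length_eq_of_nodup {q : List (Fin n)} (hq : q.Nodup) (hall : ∀ x, x ∈ q) :
    q.length = n := by
  have h : q.toFinset = Finset.univ := by ext x; simp [hall]
  rw [← List.toFinset_card_of_nodup hq, h, Finset.card_fin]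

theorem idxOf_reverse_lt {V : Type*} [DecidableEq V] {q : List V} (hq : q.Nodup) {a b : V}
    (ha : a ∈ q) (hb : b ∈ q) (hab : q.idxOf a < q.idxOf b) :
    q.reverse.idxOf b < q.reverse.idxOf a := by
  have key : ∀ x ∈ q, q.reverse.idxOf x = q.length - 1 - q.idxOf x := by
    intro x hx
    have hlt := List.idxOf_lt_length_iff.2 hx
    have h1 : q.length - 1 - q.idxOf x < q.reverse.length := by
      rw [List.length_reverse]; omega
    have h2 := (List.nodup_reverse.2 hq).idxOf_getElem _ h1
    rw [List.getElem_reverse] at h2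
    have h3 : q.length - 1 - (q.length - 1 - q.idxOf x) = q.idxOf x := by omega
    simpa only [h3, List.getElem_idxOf] using h2
  have h1 := List.idxOf_lt_length_iff.2 hb
  rw [key a ha, key b hb]
  omega

/-- The permutation that lists the vertices in the order of `q`. -/
def listPerm (q : List (Fin n)) (hq : q.Nodup) (hall : ∀ x, x ∈ q) : Equiv.Perm (Fin n) :=
  (finCongr (length_eq_of_nodup hq hall)).symm.trans (hq.getEquivOfForallMemList q hall)

theorem listPerm_apply {q : List (Fin n)} (hq : q.Nodup) (hall : ∀ x, x ∈ q) (i : Fin n) :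
    listPerm q hq hall i = q[(i : ℕ)]'(by rw [length_eq_of_nodup hq hall]; exact i.2) := rfl

theorem rank_listPerm {q : List (Fin n)} (hq : q.Nodup) (hall : ∀ x, x ∈ q) :
    rank (listPerm q hq hall) = fun v => (q.idxOf v : ℤ) := rfl

end Permutation

/-! ### Correctness and running time of the whole program -/

section

variable {n : ℕ} {G : SimpleGraph (Fin n)}

theorem PartialBfs.isBfsOrder_deg {A : AdjLists G} {R : ℕ → ℕ → Prop} {src q : List (Fin n)}
    {m : Fin n → ℕ} {h : ℕ} (H : PartialBfs G A.deg R src q m h) (hall : ∀ a, a ∈ q) :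
    IsBfsOrder G R q.idxOf m := by
  rw [show A.deg = fun v => (G.neighborSet v).ncard from funext A.deg_eq] at H
  exact H.isBfsOrder hall

/-- The constant is the sum 40 + 100 + 10 + 100 + 10 + 50 over the six phases. -/
theorem runs_equitableTreeColoring {k c : ℕ} (hk : 0 < k) (A : AdjLists G)
    (hG : IsProperIntervalGraph G) (hc : 310 * (n + G.edgeSet.ncard + 1) ≤ c) :
    Runs equitableTreeColoring (A.input k) c fun s _ =>
      ∃ σ : Equiv.Perm (Fin n), IsProperIntervalOrder G σ ∧ s.ListsOrder σ ∧
        s.Answers (algorithmResult G hk σ).1 ∧ s.GivesColoring (modColoring hk σ) := by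
  obtain ⟨r, hr⟩ := hG.exists_isUmbrella
  refine Runs.seq ((runs_setup k (by omega)).mono ?_)
  rintro s1 c1 ⟨hI1, hd1, hsrc1, hmark1, hc1⟩
  refine Runs.seq ((runs_search hI1 hd1 (by simp) (by simp) hsrc1 hmark1 (by omega)).mono ?_)
  rintro s2 c2 ⟨hI2, hd2, hc2, q, m, h, hbfs, hall, hq⟩
  refine Runs.seq ((runs_reverseQueue hI2 hq (length_eq_of_nodup hbfs.nodup hall)
    (by omega)).mono ?_)
  rintro s3 c3 ⟨hI3, hd3, hsrc3, hmark3, hc3⟩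
  refine Runs.seq ((runs_search hI3 (by rw [hd3]; exact hd2)
    (by rw [List.length_reverse, length_eq_of_nodup hbfs.nodup hall])
    (fun x => List.mem_reverse.2 (hall x)) hsrc3 hmark3 (by omega)).mono ?_)
  rintro s4 c4 ⟨hI4, hd4, hc4, q', m', h', hbfs', hall', hq'⟩
  set σ := listPerm q' hbfs'.nodup hall' with hσ
  have humb : IsUmbrella G (rank σ) := by
    rw [hσ, rank_listPerm]
    refine (hbfs'.isBfsOrder_deg hall').isUmbrella_of_two_sweeps (hbfs.isBfsOrder_deg hall)
      (fun s hs x hx => ?_) hr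
    -- What comes after `s` in the first sweep comes before it among the sources of the second,
    -- hence is already in the queue when `s` is taken.
    exact (hbfs'.source s (hall' s) hs x
      (idxOf_reverse_lt hbfs.nodup (hall s) (hall x) hx)).2
  have hlist : s4.ListsOrder σ := by
    intro i
    rw [hσ, listPerm_apply]
    simpa using seg_iff.1 hq' i (by rw [length_eq_of_nodup hbfs'.nodup hall']; exact i.2)
  refine Runs.seq ((runs_color hk hI4 hlist (by omega)).mono ?_)
  rintro s5 c5 ⟨hI5, hlist5, hcol5, hc5⟩
  refine (runs_answer hI5 hlist5 (by omega)).mono ?_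
  rintro s6 c6 ⟨ha6, h26, hc6⟩
  refine ⟨σ, humb.isProperIntervalOrder, fun i => ?_, ?_, fun v => ?_⟩
  · rw [ha6]; exact hlist5 i
  · have hiff := hasMonochromaticCycle_iff (hk := hk) humb
    by_cases hm : HasMonochromaticCycle G (modColoring hk σ)
    · rw [Mem.Answers, h26, if_pos (hiff.1 hm)]
      simp [algorithmResult, hm]
    · rw [Mem.Answers, h26, if_neg (fun h => hm (hiff.2 h))]
      simp [algorithmResult, hm]
  · rw [ha6]; exact hcol5 v

end

end EquitableTree

theorem theorem5 :
    -- the answer and the coloring are right, whichever proper interval order is used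
    (∀ (n k : ℕ) (G : SimpleGraph (Fin n)) (hk : 0 < k) (σ : Equiv.Perm (Fin n)),
      IsProperIntervalOrder G σ →
        ((algorithmResult G hk σ).1 = true ↔
          ∃ c : Fin n → Fin k, IsEquitableTreeColoring G c) ∧
        ((algorithmResult G hk σ).1 = true →
          IsEquitableTreeColoring G (algorithmResult G hk σ).2)) ∧
    -- one program carries out the algorithm, the sorting included, in linear time
    (∃ (P : Prog) (C : ℕ), ∀ (n k : ℕ) (G : SimpleGraph (Fin n)) (hk : 0 < k) (A : AdjLists G),
      IsProperIntervalGraph G →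
        ∃ (t : ℕ) (s : Mem), Exec P (A.input k) t s ∧
          t ≤ C * (n + G.edgeSet.ncard + 1) ∧
          (∃ σ : Equiv.Perm (Fin n), IsProperIntervalOrder G σ ∧ s.ListsOrder σ ∧
            s.Answers (algorithmResult G hk σ).1 ∧
            s.GivesColoring (algorithmResult G hk σ).2) ∧
          (s.Answers true ↔ ∃ c : Fin n → Fin k, IsEquitableTreeColoring G c) ∧
          (s.Answers true →
            ∃ c : Fin n → Fin k, IsEquitableTreeColoring G c ∧ s.GivesColoring c)) := by
  refine ⟨fun n k G hk σ hσ => algorithmResult_correct hk hσ.isUmbrella,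
    equitableTreeColoring, 310, fun n k G hk A hG => ?_⟩
  obtain ⟨t, s, hexec, ht, σ, hσ, hlist, hans, hcol⟩ :=
    runs_equitableTreeColoring hk A hG le_rfl
  obtain ⟨h1, h2⟩ := algorithmResult_correct hk hσ.isUmbrella
  have htrue : s.Answers true ↔ (algorithmResult G hk σ).1 = true := by
    simp only [Mem.Answers] at hans ⊢
    rw [hans]
    cases (algorithmResult G hk σ).1 <;> simp
  exact ⟨t, s, hexec, ht, ⟨σ, hσ, hlist, hans, hcol⟩, htrue.trans h1,
    fun h => ⟨_, h2 (htrue.1 h), hcol⟩⟩
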